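/- Conventions. A continuum is a non-empty compact connected metric space. A dendroid is an arcwise connected continuum $X$ that is hereditarily unicoherent, i.e. whenever a subcontinuum of $X$ is the union of two subcontinua $A,B$, the set $A\cap B$ is connected. An end-point of a dendroid $X$ is a point that is an end-point of every arc in $X$ containing it; a ramification point is the top (branching point) of some simple triod contained in $X$. A fan is a dendroid with at most one ramification point, called its top if it exists. A fan $X$ with top $v$ is smooth if $x_n\to x$ in $X$ implies $A[v,x_n]\to A[v,x]$ in the Hausdorff metric, where $A[v,y]$ is the arc in $X$ with end-points $v$ and $y$ (and $A[v,v]=\{v\}$). A Lelek fan is a smooth fan (with a top) whose set of end-points is dense. Theorem 4.9. Let $r,\rho$ be real numbers with $0<r<1<\rho$ such that, for all integers $k,\ell$, $r^k=\rho^\ell$ holds only if $k=\ell=0$. For $t>0$ put $L_t=\{(x,y)\in[0,1]^2 : y=tx\}$, and let $L_{r,\rho}=L_r\cup L_\rho$. Then the infinite Mahavier product $$M_{r,\rho}=\Big\{(x_1,x_2,x_3,\dots)\in\prod_{i=1}^\infty[0,1] : (x_i,x_{i+1})\in L_{r,\rho}\text{ for all } i\ge 1\Big\}$$ is a Lelek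 fan. Consequently, the set $L_{r,\rho}^{-1}=\{(y,x): (x,y)\in L_{r,\rho}\}$ is an arc and is the graph of an upper semicontinuous function $f$ from $[0,1]$ to the non-empty closed subsets of $[0,1]$, and the generalized inverse limit $$\Big\{(x_1,x_2,x_3,\dots)\in\prod_{i=1}^\infty[0,1] : x_i\in f(x_{i+1})\text{ for all } i\ge 1\Big\}$$ is homeomorphic to the Lelek fan: it is a Lelek fan, and it is homeomorphic to every Lelek fan. -/

import Mathlib

open Set Filter Topology TopologicalSpace

namespace ContinuumTheory

section Continua

/-- A continuum: a non-empty compact connected metrizable space.  All the notions below are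
topological, so we record the topology of the metric space and not a particular metric. -/
def IsContinuum (X : Type*) [TopologicalSpace X] : Prop :=
  ConnectedSpace X ∧ CompactSpace X ∧ MetrizableSpace X

/-- A subcontinuum of `X`: a subset which, as a subspace, is a non-empty compact connected space
(`IsConnected` includes non-emptiness; metrizability is inherited from `X`). -/
def IsSubcontinuum {X : Type*} [TopologicalSpace X] (A : Set X) : Prop :=
  IsCompact A ∧ IsConnected A

/-- The subspace `C` is unicoherent: whenever it is the union of two of its subcontinua, these
have a connected intersection. -/
def IsUnicoherent {X : Type*} [TopologicalSpace X] (C : Set X) : Prop :=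
  ∀ A B : Set X, IsSubcontinuum A → IsSubcontinuum B → A ∪ B = C → IsConnected (A ∩ B)

/-- Every subcontinuum of `X` is unicoherent. -/
def IsHereditarilyUnicoherent (X : Type*) [TopologicalSpace X] : Prop :=
  ∀ C : Set X, IsSubcontinuum C → IsUnicoherent C

/-- The subset `A` is an arc: homeomorphic to `[0, 1]`. -/
def IsArc {X : Type*} [TopologicalSpace X] (A : Set X) : Prop :=
  Nonempty (unitInterval ≃ₜ A)

/-- `A` is an arc and `x` is an end-point of it. -/
def IsArcEndpoint {X : Type*} [TopologicalSpace X] (A : Set X) (x : X) : Prop :=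
  ∃ φ : unitInterval ≃ₜ A, (φ 0 : X) = x

/-- Any two different points are the two end-points of some arc. -/
def IsArcwiseConnected (X : Type*) [TopologicalSpace X] : Prop :=
  ∀ x y : X, x ≠ y → ∃ A : Set X, IsArcEndpoint A x ∧ IsArcEndpoint A y

/-- A dendroid: an arcwise connected, hereditarily unicoherent continuum. -/
def IsDendroid (X : Type*) [TopologicalSpace X] : Prop :=
  IsContinuum X ∧ IsArcwiseConnected X ∧ IsHereditarilyUnicoherent X

/-- The set `E(X)` of end-points: points that are an end-point of every arc containing them. -/
def endPoints (X : Type*) [TopologicalSpace X] : Set X :=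
  {x | ∀ A : Set X, IsArc A → x ∈ A → IsArcEndpoint A x}

/-- The standard simple triod `([-1, 1] × {0}) ∪ ({0} × [0, 1])` in the plane. -/
def standardTriod : Set (ℝ × ℝ) :=
  (Icc (-1) 1 ×ˢ {0}) ∪ ({0} ×ˢ Icc 0 1)

/-- `T` is a simple triod and `x` is its top. -/
def IsTriodTop {X : Type*} [TopologicalSpace X] (T : Set X) (x : X) : Prop :=
  ∃ φ : standardTriod ≃ₜ T, ∃ o : standardTriod, (o : ℝ × ℝ) = (0, 0) ∧ (φ o : X) = x

/-- The set `R(X)` of ramification-points: the tops of the simple triods in `X`. -/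
def ramificationPoints (X : Type*) [TopologicalSpace X] : Set X :=
  {x | ∃ T : Set X, IsTriodTop T x}

/-- A fan: a dendroid with at most one ramification-point. -/
def IsFan (X : Type*) [TopologicalSpace X] : Prop :=
  IsDendroid X ∧ (ramificationPoints X).Subsingleton

/-- `A` is the set `A[x, y]`: an arc with end-points `x` and `y` if `x ≠ y`, and `{x}` if `x = y`.
(In a dendroid there is exactly one such set.) -/
def IsArcFromTo {X : Type*} [TopologicalSpace X] (A : Set X) (x y : X) : Prop :=
  (x = y ∧ A = {x}) ∨ (x ≠ y ∧ IsArcEndpoint A x ∧ IsArcEndpoint A y)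

/-- A smooth fan: a fan with a top `v` (its ramification-point) such that `A[v, xₙ]` converges to
`A[v, x]` whenever `xₙ` converges to `x`.  The topology on `NonemptyCompacts X` is the Vietoris
topology, which for every metric on `X` is the topology of the Hausdorff metric. -/
def IsSmoothFan (X : Type*) [TopologicalSpace X] : Prop :=
  IsFan X ∧ ∃ v ∈ ramificationPoints X,
    ∀ (x : X) (u : ℕ → X), Tendsto u atTop (𝓝 x) →
      ∀ (A : ℕ → NonemptyCompacts X) (B : NonemptyCompacts X),
        (∀ n, IsArcFromTo (A n : Set X) v (u n)) → IsArcFromTo (B : Set X) v x →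
          Tendsto A atTop (𝓝 B)

/-- A Lelek fan: a smooth fan whose set of end-points is dense. -/
def IsLelekFan (X : Type*) [TopologicalSpace X] : Prop :=
  IsSmoothFan X ∧ Dense (endPoints X)

end Continua

section InverseLimits

/-- The infinite Mahavier product of a relation `H` on `X`: the sequences all of whose pairs of
consecutive terms lie in `H`, as a subspace of the product `∏ X`. -/
def mahavierProduct {X : Type*} (H : Set (X × X)) : Set (ℕ → X) :=
  {x | ∀ i, (x i, x (i + 1)) ∈ H}

/-- The graph of a set-valued function with non-empty closed (that is, non-empty compact) values
in a compact metric space. -/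
def graph {X : Type*} [TopologicalSpace X] (F : X → NonemptyCompacts X) : Set (X × X) :=
  {p | p.2 ∈ F p.1}

/-- The generalized inverse limit with the single set-valued bonding function `F`. -/
def generalizedInverseLimit {X : Type*} [TopologicalSpace X] (F : X → NonemptyCompacts X) :
    Set (ℕ → X) :=
  {x | ∀ i, x i ∈ F (x (i + 1))}

/-- The segment `L_r = {(x, y) ∈ [0, 1]² | y = r x}`. -/
def segmentL (r : ℝ) : Set (unitInterval × unitInterval) :=
  {p | (p.2 : ℝ) = r * (p.1 : ℝ)}

/-- `L_{r,ρ} = L_r ∪ L_ρ`. -/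
def unionL (r ρ : ℝ) : Set (unitInterval × unitInterval) :=
  segmentL r ∪ segmentL ρ

/-- The inverse relation. -/
def inverseRel {X : Type*} (G : Set (X × X)) : Set (X × X) :=
  {p | (p.2, p.1) ∈ G}

/-- `M_{r,ρ}`, the infinite Mahavier product of `L_{r,ρ}`, a subspace of the Hilbert cube. -/
def mahavierM (r ρ : ℝ) : Set (ℕ → unitInterval) :=
  mahavierProduct (unionL r ρ)

/-- `r` and `ρ` never connect. -/
def NeverConnect (r ρ : ℝ) : Prop :=
  r < 1 ∧ 1 < ρ ∧ ∀ k l : ℤ, r ^ k = ρ ^ l ↔ (k = 0 ∧ l = 0)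

end InverseLimits

end ContinuumTheory

/-! A smooth fan behaves like a part of the cone over the Cantor set. This is made precise by a
`FanChart`: a continuous height vanishing only at the top, and a code of legs in `ℕ → Bool`,
continuous off the top, such that code and height determine a point and every leg is full below each
of its points. By compactness, convergence in the fan is convergence of heights and, away from the
top, of codes (`FanChart.tendsto`). Hence a chart yields a dendroid with no ramification point off
the top, smoothness at the top, and a description of the end-points off the top as the highest
points of their legs.

For the Mahavier product, the height is the first coordinate and the code is the sequence of
multipliers `r`, `ρ`. A point with some coordinate equal to `1` cannot be scaled up, so it is an
end-point. Since `log r / log ρ` is irrational, the numbers `r ^ a * ρ ^ b` are dense in the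
positive reals. So one can follow a long initial piece of any nonzero sequence, scaled by a factor
close to `1`, and continue it until it hits `1` exactly (`exists_endPoint_near`). This makes the
end-points dense.

Uniqueness works for arbitrary Lelek fans. First, every smooth fan has a chart
(`IsSmoothFan.exists_chart`): a weighted sum of distances to the arcs from the top gives the height,
and the levels are totally disconnected, so clopen unions of legs separate legs and countably many
of them give the code. Next, if end-points are dense, the function sending a code to the height of
its leg is a `LelekFunction`. A back-and-forth construction refines matched clopen partitions of two
code spaces while the logarithmic ratios of the suprema change by summable amounts. In the limit it
gives a homeomorphism of code spaces which carries one leg height to the other up to a continuous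
positive factor (`LelekFunction.exists_homeomorph`). Stretching each leg by that factor is a
homeomorphism of the fans. -/

namespace ContinuumTheory

/-! ### Arcs and their parametrizations. -/

section Arcs

variable {X : Type*} [TopologicalSpace X]

theorem isArcEndpoint_range_zero [T2Space X] {γ : unitInterval → X} (hγ : Continuous γ)
    (hi : Function.Injective γ) : IsArcEndpoint (range γ) (γ 0) :=
  ⟨(hγ.isClosedEmbedding hi).isEmbedding.toHomeomorph, rfl⟩

theorem IsArcEndpoint.isArc {A : Set X} {x : X} (h : IsArcEndpoint A x) : IsArc A :=
  ⟨h.choose⟩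

theorem isArcEndpoint_range_one [T2Space X] {γ : unitInterval → X} (hγ : Continuous γ)
    (hi : Function.Injective γ) : IsArcEndpoint (range γ) (γ 1) := by
  have := isArcEndpoint_range_zero (hγ.comp unitInterval.continuous_symm)
    (hi.comp unitInterval.symm_bijective.injective)
  rw [unitInterval.symm_bijective.surjective.range_comp] at this
  simpa using this

theorem IsArcEndpoint.exists_param {A : Set X} {x : X} (h : IsArcEndpoint A x) :
    ∃ γ : unitInterval → X, Continuous γ ∧ Function.Injective γ ∧ range γ = A ∧ γ 0 = x := by
  obtain ⟨φ, h0⟩ := h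
  refine ⟨fun t => φ t, by fun_prop, fun s t hst => φ.injective (Subtype.ext hst), ?_, h0⟩
  ext x
  constructor
  · rintro ⟨t, rfl⟩
    exact (φ t).2
  · intro hx
    exact ⟨φ.symm ⟨x, hx⟩, by simp⟩

theorem IsArc.exists_param {A : Set X} (h : IsArc A) :
    ∃ γ : unitInterval → X, Continuous γ ∧ Function.Injective γ ∧ range γ = A := by
  obtain ⟨φ⟩ := h
  obtain ⟨γ, h1, h2, h3, -⟩ := IsArcEndpoint.exists_param ⟨φ, rfl⟩
  exact ⟨γ, h1, h2, h3⟩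

/-- The only end-points of a parametrized arc are the images of `0` and `1`. -/
theorem IsArcEndpoint.eq_zero_or_one [T2Space X] {γ : unitInterval → X} (hγ : Continuous γ)
    (hi : Function.Injective γ) {s : unitInterval} (h : IsArcEndpoint (range γ) (γ s)) :
    s = 0 ∨ s = 1 := by
  obtain ⟨δ, hδ, hδi, hr, h0⟩ := h.exists_param
  -- An arc minus an end-point stays connected, whereas removing an interior parameter `s` would
  -- disconnect the interval.
  have hpre : IsPreconnected (γ ⁻¹' (δ '' (Ioi 0))) := by
    have h1 : IsPreconnected (δ '' (Ioi 0)) := isPreconnected_Ioi.image _ hδ.continuousOn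
    have h2 : γ '' (γ ⁻¹' (δ '' (Ioi 0))) = δ '' (Ioi 0) := by
      rw [image_preimage_eq_inter_range, ← hr]
      exact inter_eq_left.2 (image_subset_range _ _)
    rw [← h2] at h1
    exact (hγ.isClosedEmbedding hi).isInducing.isPreconnected_image.1 h1
  have hmem : ∀ t : unitInterval, t ≠ s → t ∈ γ ⁻¹' (δ '' (Ioi 0)) := by
    intro t ht
    obtain ⟨u, hu⟩ : γ t ∈ range δ := hr ▸ mem_range_self t
    refine ⟨u, ?_, hu⟩
    refine bot_lt_iff_ne_bot.2 fun h : u = 0 => ht (hi ?_)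
    rw [← hu, ← h0, h]
  by_contra! hs
  have hlt0 : 0 < s := bot_lt_iff_ne_bot.2 hs.1
  have hlt1 : s < 1 := lt_top_iff_ne_top.2 hs.2
  obtain ⟨u, hu, hus⟩ := hpre.ordConnected.out (hmem 0 hlt0.ne) (hmem 1 hlt1.ne')
    ⟨hlt0.le, hlt1.le⟩
  rw [← h0] at hus
  exact (ne_of_gt hu) (hδi hus)

theorem exists_param_of_isArcEndpoint [T2Space X] {A : Set X} {x y : X} (hxy : x ≠ y)
    (hx : IsArcEndpoint A x) (hy : IsArcEndpoint A y) :
    ∃ γ : unitInterval → X, Continuous γ ∧ Function.Injective γ ∧ range γ = A ∧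
      γ 0 = x ∧ γ 1 = y := by
  obtain ⟨γ, hγ, hi, hr, h0⟩ := hx.exists_param
  refine ⟨γ, hγ, hi, hr, h0, ?_⟩
  have hyA : y ∈ A := by
    obtain ⟨φ, h⟩ := hy
    exact h ▸ (φ 0).2
  obtain ⟨s, rfl⟩ := hr.symm ▸ hyA
  subst hr
  rcases hy.eq_zero_or_one hγ hi with rfl | rfl
  · exact absurd h0.symm hxy
  · rfl

/-- A set whose trace on an arc is connected contains the subarc between any two of its points
on that arc. -/
theorem image_Icc_subset_of_isPreconnected [T2Space X] {γ : unitInterval → X} (hγ : Continuous γ)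
    (hi : Function.Injective γ) {K : Set X} (hK : IsPreconnected (K ∩ range γ))
    {s t : unitInterval} (hs : γ s ∈ K) (ht : γ t ∈ K) : γ '' Icc s t ⊆ K := by
  have hpre : IsPreconnected (γ ⁻¹' K) := by
    rw [← image_preimage_eq_inter_range] at hK
    exact (hγ.isClosedEmbedding hi).isInducing.isPreconnected_image.1 hK
  rintro _ ⟨u, hu, rfl⟩
  exact hpre.ordConnected.out hs ht hu

theorem isArcEndpoint_image_Icc [T2Space X] {a b : ℝ} (hab : a < b) {γ : ℝ → X}
    (hγ : ContinuousOn γ (Icc a b)) (hi : InjOn γ (Icc a b)) :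
    IsArcEndpoint (γ '' Icc a b) (γ a) ∧ IsArcEndpoint (γ '' Icc a b) (γ b) := by
  let e := (iccHomeoI a b hab).symm
  let δ : unitInterval → X := fun t => γ (e t)
  have hδ : Continuous δ := hγ.comp_continuous (by fun_prop) fun t => (e t).2
  have hδi : Function.Injective δ := fun s t h =>
    e.injective (Subtype.ext (hi (e s).2 (e t).2 h))
  have hr : range δ = γ '' Icc a b := by
    ext x
    constructor
    · rintro ⟨t, rfl⟩
      exact ⟨_, (e t).2, rfl⟩
    · rintro ⟨t, ht, rfl⟩
      exact ⟨e.symm ⟨t, ht⟩, by simp [δ]⟩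
  have h0 := isArcEndpoint_range_zero hδ hδi
  have h1 := isArcEndpoint_range_one hδ hδi
  rw [hr] at h0 h1
  constructor
  · convert h0
    simp [e]
  · convert h1
    simp [e]

end Arcs

/-! ### Simple triods. -/

section Triods

variable {X : Type*} [TopologicalSpace X]

theorem mem_standardTriod {p : ℝ × ℝ} :
    p ∈ standardTriod ↔ (p.1 ∈ Icc (-1 : ℝ) 1 ∧ p.2 = 0) ∨ (p.1 = 0 ∧ p.2 ∈ Icc (0 : ℝ) 1) := by
  simp [standardTriod, mem_prod]

/-- Three arcs issuing from the same point and otherwise disjoint form a simple triod. -/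
theorem exists_isTriodTop [T2Space X] {x : X} {γ : Fin 3 → unitInterval → X}
    (hγ : ∀ i, Continuous (γ i)) (hi : ∀ i, Function.Injective (γ i)) (h0 : ∀ i, γ i 0 = x)
    (hd : ∀ i j s t, i ≠ j → γ i s = γ j t → s = 0) : ∃ T : Set X, IsTriodTop T x := by
  let pr : ℝ → unitInterval := projIcc 0 1 zero_le_one
  have hpr : Continuous pr := continuous_projIcc
  have hpr0 : pr 0 = 0 := projIcc_of_le_left _ le_rfl
  have hprv : ∀ a, 0 ≤ a → a ≤ 1 → (pr a : ℝ) = a := fun a h1 h2 => by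
    simp [pr, projIcc_of_mem _ (show a ∈ Icc (0 : ℝ) 1 from ⟨h1, h2⟩)]
  -- On the triod, `p.2 ≤ |p.1|` holds exactly on the horizontal bar, so the three pieces only have
  -- to agree at the origin, where each gives `x`.
  let g : ℝ × ℝ → X := fun p =>
    if p.2 ≤ |p.1| then (if p.1 ≤ 0 then γ 0 (pr (-p.1)) else γ 1 (pr p.1)) else γ 2 (pr p.2)
  let G : standardTriod → X := fun p => g p
  have hG : Continuous G := by
    refine Continuous.if_le ?_ ?_ (by fun_prop) (by fun_prop) ?_
    · refine Continuous.if_le ?_ ?_ (by fun_prop) continuous_const ?_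
      · exact (hγ 0).comp (hpr.comp (by fun_prop))
      · exact (hγ 1).comp (hpr.comp (by fun_prop))
      · rintro p hp
        simp [hp, hpr0, h0]
    · exact (hγ 2).comp (hpr.comp (by fun_prop))
    · rintro ⟨⟨a, b⟩, hp⟩ hp2
      simp only at hp2
      obtain ⟨rfl, rfl⟩ : a = 0 ∧ b = 0 := by
        rcases mem_standardTriod.1 hp with ⟨-, h⟩ | ⟨h, -⟩ <;> simp only at h <;> subst h <;>
          simp_all
        simp [abs_eq_zero.1 hp2.symm]
      simp [hpr0, h0]
  let d : Fin 3 → ℝ × ℝ := ![(-1, 0), (1, 0), (0, 1)]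
  have hrep : ∀ p : standardTriod, ∃ i, ∃ s : unitInterval, (p : ℝ × ℝ) = (s : ℝ) • d i ∧
      G p = γ i s := by
    rintro ⟨⟨a, b⟩, hp⟩
    rcases mem_standardTriod.1 hp with ⟨⟨h1, h2⟩, h⟩ | ⟨h, h1, h2⟩ <;> simp only at h h1 h2 <;>
      subst h
    · rcases le_or_gt a 0 with ha | ha
      · refine ⟨0, pr (-a), ?_, ?_⟩
        · rw [hprv _ (by linarith) (by linarith)]
          simp [d]
        · simp [G, g, ha]
      · refine ⟨1, pr a, ?_, ?_⟩
        · rw [hprv _ (by linarith) (by linarith)]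
          simp [d]
        · simp [G, g, ha.not_ge]
    · refine ⟨2, pr b, ?_, ?_⟩
      · rw [hprv _ (by linarith) (by linarith)]
        simp [d]
      · rcases h1.eq_or_lt with rfl | hb
        · simp [G, g, hpr0, h0]
        · simp [G, g, hb.not_ge]
  have hGi : Function.Injective G := by
    intro p q hpq
    obtain ⟨i, s, hp, hps⟩ := hrep p
    obtain ⟨j, t, hq, hqt⟩ := hrep q
    rw [hps, hqt] at hpq
    apply Subtype.ext
    rw [hp, hq]
    by_cases hij : i = j
    · subst hij
      rw [hi i hpq]
    · rw [hd i j s t hij hpq, hd j i t s (Ne.symm hij) hpq.symm]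
      simp
  have hcpt : IsCompact standardTriod := by
    unfold standardTriod
    exact (isCompact_Icc.prod isCompact_singleton).union (isCompact_singleton.prod isCompact_Icc)
  have : CompactSpace standardTriod := isCompact_iff_compactSpace.1 hcpt
  refine ⟨range G, (hG.isClosedEmbedding hGi).isEmbedding.toHomeomorph, ⟨(0, 0), ?_⟩, rfl, ?_⟩
  · simp [mem_standardTriod]
  · change g (0, 0) = x
    simp [g, hpr0, h0]

/-- A simple triod consists of three continua which pairwise meet only in its top. -/
theorem IsTriodTop.exists_legs {T : Set X} {x : X} (h : IsTriodTop T x) :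
    ∃ J : Fin 3 → Set X, (∀ i, IsCompact (J i) ∧ IsPreconnected (J i) ∧ x ∈ J i ∧
      ∃ a ∈ J i, a ≠ x) ∧ ∀ i j, i ≠ j → J i ∩ J j ⊆ {x} := by
  obtain ⟨φ, o, ho, rfl⟩ := h
  let d : Fin 3 → ℝ × ℝ := ![(-1, 0), (1, 0), (0, 1)]
  have hmem : ∀ i, ∀ s : unitInterval, ((s : ℝ) • d i) ∈ standardTriod := by
    intro i s
    have h1 := s.2.1
    have h2 := s.2.2
    rw [mem_standardTriod]
    fin_cases i
    · left; simp [d]; grind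
    · left; simp [d]; grind
    · right; simp [d]
  let p : Fin 3 → unitInterval → X := fun i s => φ ⟨(s : ℝ) • d i, hmem i s⟩
  have hp : ∀ i, Continuous (p i) := fun i => by
    refine continuous_subtype_val.comp (φ.continuous.comp (Continuous.subtype_mk ?_ _))
    fun_prop
  have ho' : o = ⟨0, by simp [mem_standardTriod]⟩ := Subtype.ext ho
  refine ⟨fun i => range (p i), fun i => ⟨isCompact_range (hp i), isPreconnected_range (hp i),
    ⟨0, by simp [p, ho']⟩, p i 1, mem_range_self _, ?_⟩, ?_⟩
  · intro h
    have := congrArg Subtype.val (φ.injective (Subtype.ext h))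
    rw [ho] at this
    fin_cases i <;> simp [d] at this
  · rintro i j hij _ ⟨⟨s, rfl⟩, t, ht⟩
    have := congrArg Subtype.val (φ.injective (Subtype.ext ht))
    have hs0 : (s : ℝ) • d i = 0 := by
      have h1 := s.2.1
      have h2 := t.2.1
      fin_cases i <;> fin_cases j <;> simp [d] at this hij ⊢ <;>
        first | (apply Subtype.ext; simp; done) | grind
    simp [p, ho', hs0]

end Triods

/-! ### Fan charts and the fan structure they induce. -/

section Charts

/-- A fan chart on `X`: a height function `μ` vanishing exactly at the top `v`, and a continuous
coding `π` of the legs, i.e. the points other than `v` are determined by leg and height, and every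
leg contains with a point all the points below it. -/
structure FanChart {X : Type*} [TopologicalSpace X] (v : X) (μ : X → ℝ) (π : X → ℕ → Bool) :
    Prop where
  continuous_height : Continuous μ
  height_nonneg : ∀ x, 0 ≤ μ x
  height_top : μ v = 0
  eq_top : ∀ x, μ x = 0 → x = v
  continuousOn_leg : ContinuousOn π {v}ᶜ
  eq_of : ∀ x y, x ≠ v → y ≠ v → π x = π y → μ x = μ y → x = y
  exists_below : ∀ x t, 0 < t → t ≤ μ x → ∃ y, π y = π x ∧ μ y = t

variable {X : Type*} [TopologicalSpace X] {v : X} {μ : X → ℝ} {π : X → ℕ → Bool}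

namespace FanChart

theorem pos (h : FanChart v μ π) {x : X} (hx : x ≠ v) : 0 < μ x :=
  (h.height_nonneg x).lt_of_ne fun h0 => hx (h.eq_top x h0.symm)

theorem ne_top (h : FanChart v μ π) {x : X} (hx : 0 < μ x) : x ≠ v := by
  rintro rfl
  exact hx.ne' h.height_top

theorem continuousAt_leg [T2Space X] (h : FanChart v μ π) {x : X} (hx : x ≠ v) :
    ContinuousAt π x :=
  h.continuousOn_leg.continuousAt (isOpen_compl_singleton.mem_nhds hx)

/-- Along every finer ultrafilter a limit `z` exists by compactness. It has the height of `x` and,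
if `x` is not the top, also its code, so `z = x`. At the top the height alone decides, which is why
codes need not converge there. -/
theorem tendsto [CompactSpace X] [T2Space X] (h : FanChart v μ π) {ι : Type*} {l : Filter ι}
    {u : ι → X} {x : X} (hμ : Tendsto (fun i => μ (u i)) l (𝓝 (μ x)))
    (hπ : x ≠ v → Tendsto (fun i => π (u i)) l (𝓝 (π x))) : Tendsto u l (𝓝 x) := by
  rw [tendsto_iff_ultrafilter]
  intro g hg
  obtain ⟨z, -, hz⟩ := isCompact_univ.ultrafilter_le_nhds (g.map u) (by simp)
  have hz' : Tendsto u g (𝓝 z) := hz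
  have hμz : μ z = μ x :=
    tendsto_nhds_unique ((h.continuous_height.tendsto z).comp hz') (hμ.mono_left hg)
  suffices z = x by rwa [this] at hz'
  by_cases hx : x = v
  · rw [hx] at hμz ⊢
    exact h.eq_top _ (hμz.trans h.height_top)
  · have hzv : z ≠ v := h.ne_top (hμz ▸ h.pos hx)
    exact h.eq_of z x hzv hx (tendsto_nhds_unique ((h.continuousAt_leg hzv).tendsto.comp hz')
      ((hπ hx).mono_left hg)) hμz

open Classical in
/-- The point of height `t` on the leg of `x` (with `t` truncated to `[0, μ x]`). -/
noncomputable def legPoint (h : FanChart v μ π) (x : X) (t : ℝ) : X :=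
  if ht : 0 < t ∧ 0 < μ x then
    (h.exists_below x (min t (μ x)) (lt_min ht.1 ht.2) (min_le_right _ _)).choose
  else v

theorem height_legPoint (h : FanChart v μ π) (x : X) (t : ℝ) :
    μ (h.legPoint x t) = max 0 (min t (μ x)) := by
  unfold legPoint
  split_ifs with ht
  · rw [(h.exists_below x (min t (μ x)) (lt_min ht.1 ht.2) (min_le_right _ _)).choose_spec.2]
    exact (max_eq_right (lt_min ht.1 ht.2).le).symm
  · rw [h.height_top, max_eq_left]
    rw [not_and_or, not_lt, not_lt] at ht
    exact min_le_iff.2 ht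

theorem height_legPoint_of_mem (h : FanChart v μ π) {x : X} {t : ℝ} (ht : t ∈ Icc 0 (μ x)) :
    μ (h.legPoint x t) = t := by
  rw [h.height_legPoint, min_eq_left ht.2, max_eq_right ht.1]

theorem leg_legPoint (h : FanChart v μ π) {x : X} {t : ℝ} (hx : x ≠ v) (ht : 0 < t) :
    π (h.legPoint x t) = π x := by
  unfold legPoint
  have ht' : 0 < t ∧ 0 < μ x := ⟨ht, h.pos hx⟩
  rw [dif_pos ht']
  exact (h.exists_below x (min t (μ x)) (lt_min ht'.1 ht'.2) (min_le_right _ _)).choose_spec.1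

theorem legPoint_zero (h : FanChart v μ π) (x : X) : h.legPoint x 0 = v := by
  simp [legPoint]

theorem legPoint_eq (h : FanChart v μ π) {x y : X} (hy : y ≠ v) (hπ : π y = π x)
    (hμ : μ y ≤ μ x) : h.legPoint x (μ y) = y := by
  have hy0 := h.pos hy
  have hx0 := hy0.trans_le hμ
  have he : μ (h.legPoint x (μ y)) = μ y := h.height_legPoint_of_mem ⟨hy0.le, hμ⟩
  exact h.eq_of _ _ (h.ne_top (by rwa [he])) hy
    ((h.leg_legPoint (h.ne_top hx0) hy0).trans hπ.symm) he

theorem legPoint_height (h : FanChart v μ π) (x : X) : h.legPoint x (μ x) = x := by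
  by_cases hx : x = v
  · subst hx
    rw [h.height_top, legPoint_zero]
  · exact h.legPoint_eq hx rfl le_rfl

/-- The source of smoothness: the height of the leg point is a continuous expression in both
variables, and where that point is not the top its code is locally the code of the first variable.
-/
theorem continuous_legPoint [CompactSpace X] [T2Space X] (h : FanChart v μ π) :
    Continuous fun p : X × ℝ => h.legPoint p.1 p.2 := by
  rw [continuous_iff_continuousAt]
  rintro ⟨x, t⟩
  have hμ : Continuous fun p : X × ℝ => μ (h.legPoint p.1 p.2) := by
    simp_rw [height_legPoint]
    have := h.continuous_height
    fun_prop
  refine h.tendsto hμ.continuousAt fun hne => ?_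
  have hpos := h.pos hne
  simp only [height_legPoint, lt_max_iff, lt_min_iff, lt_irrefl, false_or] at hpos
  have hx := h.ne_top hpos.2
  have h1 : Tendsto (fun p : X × ℝ => π p.1) (𝓝 (x, t)) (𝓝 (π x)) :=
    (h.continuousAt_leg hx).tendsto.comp continuous_fst.continuousAt
  simp only [h.leg_legPoint hx hpos.1]
  refine h1.congr' ?_
  filter_upwards [(isOpen_compl_singleton.preimage continuous_fst).mem_nhds
    (show (x, t).1 ∈ ({v}ᶜ : Set X) from hx), (isOpen_Ioi.preimage continuous_snd).mem_nhds
    (show (x, t).2 ∈ Ioi 0 from hpos.1)] with p hp hp'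
  exact (h.leg_legPoint hp hp').symm

theorem continuous_legPoint_left [CompactSpace X] [T2Space X] (h : FanChart v μ π) (x : X) :
    Continuous (h.legPoint x) :=
  h.continuous_legPoint.comp (by fun_prop : Continuous fun t : ℝ => (x, t))

theorem injOn_legPoint (h : FanChart v μ π) (x : X) : InjOn (h.legPoint x) (Icc 0 (μ x)) := by
  intro s hs t ht hst
  rw [← h.height_legPoint_of_mem hs, hst, h.height_legPoint_of_mem ht]

theorem isPreconnected_image_legPoint [CompactSpace X] [T2Space X] (h : FanChart v μ π) (x : X)
    (a b : ℝ) : IsPreconnected (h.legPoint x '' Icc a b) :=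
  isPreconnected_Icc.image _ (h.continuous_legPoint_left x).continuousOn

/-- A closed connected set which contains a point `x` and a point `y` not above `z` contains the
point `z` of the leg of `x` below `x`. -/
theorem mem_of_isPreconnected [CompactSpace X] [T2Space X] (h : FanChart v μ π) {K : Set X}
    (hc : IsClosed K) (hK : IsPreconnected K) {x y z : X} (hx : x ∈ K) (hy : y ∈ K) (hz : z ≠ v)
    (hzx : π z = π x) (hlt : μ z < μ x) (hyz : y ≠ v → π y = π x → μ y ≤ μ z) : z ∈ K := by
  by_contra hzK
  have hz0 := h.pos hz
  have hsub : ∀ w, μ z ≤ μ w → w ∈ ({v}ᶜ : Set X) := fun w hw => h.ne_top (hz0.trans_le hw)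
  -- If `z ∉ K`, then `π x` avoids the compact set `P` of codes occurring in `K` at the height of
  -- `z`. A clopen `U` around `π x` missing `P`, and missing `π y` when that differs from `π x`,
  -- makes the part of `K` above this height with code in `U` relatively clopen. It contains `x` but
  -- not `y`.
  let P : Set (ℕ → Bool) := π '' (K ∩ {w | μ w = μ z})
  have hP : IsClosed P := by
    refine IsCompact.isClosed (IsCompact.image_of_continuousOn ?_ (h.continuousOn_leg.mono ?_))
    · exact (hc.inter (isClosed_eq h.continuous_height continuous_const)).isCompact
    · rintro w ⟨-, hw⟩
      exact hsub w (le_of_eq hw.symm)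
  let Q : Set (ℕ → Bool) := {π y} \ {π x}
  have hQ : IsClosed Q := ((finite_singleton _).subset sdiff_subset).isClosed
  obtain ⟨U, hU, hxU, hUPQ⟩ := compact_exists_isClopen_in_isOpen
    (hP.isOpen_compl.inter hQ.isOpen_compl) (x := π x) (by
      refine ⟨?_, fun hq => hq.2 rfl⟩
      rintro ⟨w, ⟨hwK, hw⟩, hwx⟩
      have : w = z := h.eq_of w z (hsub w (le_of_eq hw.symm)) hz (hwx.trans hzx.symm) hw
      exact hzK (this ▸ hwK))
  have hO1 : IsOpen ({w | μ z < μ w} ∩ π ⁻¹' U) :=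
    (h.continuousOn_leg.mono fun w (hw : μ z < μ w) => hsub w hw.le).isOpen_inter_preimage
      (isOpen_lt continuous_const h.continuous_height) hU.isOpen
  have hO2 : IsClosed ({w | μ z ≤ μ w} ∩ π ⁻¹' U) :=
    (h.continuousOn_leg.mono fun w hw => hsub w hw).preimage_isClosed_of_isClosed
      (isClosed_le continuous_const h.continuous_height) hU.isClosed
  obtain ⟨w, -, hw1, hw2⟩ := hK _ _ hO1 hO2.isOpen_compl (by
    intro w hw
    by_cases hwU : π w ∈ U
    · rcases lt_trichotomy (μ w) (μ z) with h1 | h1 | h1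
      · exact Or.inr fun h2 => h1.not_ge h2.1
      · exact absurd ⟨w, ⟨hw, h1⟩, rfl⟩ (hUPQ hwU).1
      · exact Or.inl ⟨h1, hwU⟩
    · exact Or.inr fun h2 => hwU h2.2) ⟨x, hx, hlt, hxU⟩ ⟨y, hy, by
    rintro ⟨h1, h2⟩
    have hyv := hsub y h1
    have hyx : π y = π x := by
      by_contra hne
      exact (hUPQ h2).2 ⟨rfl, hne⟩
    have : y = z := h.eq_of y z hyv hz (hyx.trans hzx.symm) (le_antisymm (hyz hyv hyx) h1)
    exact hzK (this ▸ hy)⟩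
  exact hw2 ⟨(show μ z < μ w from hw1.1).le, hw1.2⟩

/-- A connected set which meets two legs contains the top. -/
theorem top_mem_of_isPreconnected (h : FanChart v μ π) {K : Set X}
    (hK : IsPreconnected K) {x y : X} (hx : x ∈ K) (hy : y ∈ K) (hxy : π x ≠ π y) : v ∈ K := by
  by_contra hv
  have : IsPreconnected (π '' K) := hK.image _ (h.continuousOn_leg.mono fun w hw h0 => hv (h0 ▸ hw))
  exact hxy (this.subsingleton ⟨x, hx, rfl⟩ ⟨y, hy, rfl⟩)

end FanChart

/-- `K` contains, with any two of its points, the points between them. -/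
def LegConvex (v : X) (μ : X → ℝ) (π : X → ℕ → Bool) (K : Set X) : Prop :=
  (∀ x ∈ K, ∀ y ∈ K, ∀ z, z ≠ v → π z = π x → μ z < μ x → (y ≠ v → π y = π x → μ y ≤ μ z) →
    z ∈ K) ∧ ∀ x ∈ K, ∀ y ∈ K, π x ≠ π y → v ∈ K

theorem LegConvex.inter {Y : Type*} {v : Y} {μ : Y → ℝ} {π : Y → ℕ → Bool} {A B : Set Y}
    (hA : LegConvex v μ π A) (hB : LegConvex v μ π B) :
    LegConvex v μ π (A ∩ B) :=
  ⟨fun x hx y hy z h1 h2 h3 h4 => ⟨hA.1 x hx.1 y hy.1 z h1 h2 h3 h4,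
    hB.1 x hx.2 y hy.2 z h1 h2 h3 h4⟩, fun x hx y hy hxy => ⟨hA.2 x hx.1 y hy.1 hxy,
    hB.2 x hx.2 y hy.2 hxy⟩⟩

namespace FanChart

theorem legConvex [CompactSpace X] [T2Space X] (h : FanChart v μ π) {K : Set X}
    (hc : IsClosed K) (hK : IsPreconnected K) : LegConvex v μ π K :=
  ⟨fun _ hx _ hy _ h1 h2 h3 h4 => h.mem_of_isPreconnected hc hK hx hy h1 h2 h3 h4,
    fun _ hx _ hy hxy => h.top_mem_of_isPreconnected hK hx hy hxy⟩

theorem image_legPoint_subset (h : FanChart v μ π) {K : Set X} (hK : LegConvex v μ π K)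
    {x y : X} (hx : x ∈ K) (hy : y ∈ K) (hyv : y ≠ v) :
    h.legPoint x '' Icc (μ y) (μ x) ⊆ K := by
  rintro _ ⟨t, ht, rfl⟩
  have ht0 : 0 < t := (h.pos hyv).trans_le ht.1
  have hxv : x ≠ v := h.ne_top (ht0.trans_le ht.2)
  have hm := h.height_legPoint_of_mem ⟨ht0.le, ht.2⟩
  rcases ht.2.eq_or_lt with rfl | hlt
  · rwa [legPoint_height]
  · refine hK.1 x hx y hy _ (h.ne_top (by rwa [hm])) (h.leg_legPoint hxv ht0) (by rwa [hm]) ?_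
    intro _ _
    rw [hm]
    exact ht.1

theorem image_legPoint_zero_subset (h : FanChart v μ π) {K : Set X} (hK : LegConvex v μ π K)
    {x : X} (hx : x ∈ K) (hv : v ∈ K) : h.legPoint x '' Icc 0 (μ x) ⊆ K := by
  rintro _ ⟨t, ht, rfl⟩
  rcases ht.1.eq_or_lt with rfl | ht0
  · rwa [legPoint_zero]
  have hm := h.height_legPoint_of_mem ht
  have hxv : x ≠ v := h.ne_top (ht0.trans_le ht.2)
  rcases ht.2.eq_or_lt with rfl | hlt
  · rwa [legPoint_height]
  · exact hK.1 x hx v hv _ (h.ne_top (by rwa [hm])) (h.leg_legPoint hxv ht0) (by rwa [hm])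
      fun h0 => absurd rfl h0

/-- Two points of `K` are joined inside `K` by a segment of one leg or by two segments through the
top. Leg-convexity is thus a pointwise criterion for connectedness of closed sets. It survives
intersections, and this gives hereditary unicoherence. -/
theorem isPreconnected_of_legConvex [CompactSpace X] [T2Space X] (h : FanChart v μ π) {K : Set X}
    (hK : LegConvex v μ π K) : IsPreconnected K := by
  refine isPreconnected_of_forall_pair fun x hx y hy => ?_
  have key : ∀ x ∈ K, ∀ y ∈ K, π x = π y → x ≠ v → y ≠ v → μ y ≤ μ x →
      ∃ t ⊆ K, x ∈ t ∧ y ∈ t ∧ IsPreconnected t := by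
    intro x hx y hy hxy hxv hyv hμ
    exact ⟨_, h.image_legPoint_subset hK hx hy hyv,
      ⟨μ x, ⟨hμ, le_rfl⟩, h.legPoint_height x⟩,
      ⟨μ y, ⟨le_rfl, hμ⟩, h.legPoint_eq hyv hxy.symm hμ⟩, h.isPreconnected_image_legPoint _ _ _⟩
  by_cases hxy : π x = π y ∧ x ≠ v ∧ y ≠ v
  · rcases le_total (μ y) (μ x) with hμ | hμ
    · exact key x hx y hy hxy.1 hxy.2.1 hxy.2.2 hμ
    · obtain ⟨t, h1, h2, h3, h4⟩ := key y hy x hx hxy.1.symm hxy.2.2 hxy.2.1 hμ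
      exact ⟨t, h1, h3, h2, h4⟩
  · have hv : v ∈ K := by
      by_cases hxv : x = v
      · exact hxv ▸ hx
      by_cases hyv : y = v
      · exact hyv ▸ hy
      exact hK.2 x hx y hy fun he => hxy ⟨he, hxv, hyv⟩
    refine ⟨_, union_subset (h.image_legPoint_zero_subset hK hx hv)
      (h.image_legPoint_zero_subset hK hy hv),
      Or.inl ⟨μ x, ⟨h.height_nonneg x, le_rfl⟩, h.legPoint_height x⟩,
      Or.inr ⟨μ y, ⟨h.height_nonneg y, le_rfl⟩, h.legPoint_height y⟩,
      IsPreconnected.union v ?_ ?_ (h.isPreconnected_image_legPoint _ _ _)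
        (h.isPreconnected_image_legPoint _ _ _)⟩
    · exact ⟨0, ⟨le_rfl, h.height_nonneg x⟩, h.legPoint_zero x⟩
    · exact ⟨0, ⟨le_rfl, h.height_nonneg y⟩, h.legPoint_zero y⟩

theorem connectedSpace [CompactSpace X] [T2Space X] (h : FanChart v μ π) : ConnectedSpace X := by
  have : PreconnectedSpace X := ⟨h.isPreconnected_of_legConvex
    ⟨fun _ _ _ _ _ _ _ _ _ => mem_univ _, fun _ _ _ _ _ => mem_univ _⟩⟩
  have : Nonempty X := ⟨v⟩
  exact ConnectedSpace.mk inferInstance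

theorem isHereditarilyUnicoherent [CompactSpace X] [T2Space X] (h : FanChart v μ π) :
    IsHereditarilyUnicoherent X := by
  rintro C hC A B hA hB rfl
  constructor
  · obtain ⟨x, -, hx⟩ := isPreconnected_closed_iff.1 hC.2.isPreconnected A B hA.1.isClosed
      hB.1.isClosed le_rfl (hA.2.nonempty.mono fun x hx => ⟨Or.inl hx, hx⟩)
      (hB.2.nonempty.mono fun x hx => ⟨Or.inr hx, hx⟩)
    exact ⟨x, hx⟩
  · exact h.isPreconnected_of_legConvex
      ((h.legConvex hA.1.isClosed hA.2.isPreconnected).inter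
        (h.legConvex hB.1.isClosed hB.2.isPreconnected))

theorem isArcwiseConnected [CompactSpace X] [T2Space X] (h : FanChart v μ π) :
    IsArcwiseConnected X := by
  intro x y hxy
  have key : ∀ x y : X, π x = π y → x ≠ v → μ x < μ y →
      ∃ A : Set X, IsArcEndpoint A x ∧ IsArcEndpoint A y := by
    intro x y hπ hxv hμ
    obtain ⟨h1, h2⟩ := isArcEndpoint_image_Icc hμ (h.continuous_legPoint_left y).continuousOn
      ((h.injOn_legPoint y).mono (Icc_subset_Icc_left (h.height_nonneg x)))
    rw [h.legPoint_eq hxv hπ hμ.le] at h1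
    rw [h.legPoint_height] at h2
    exact ⟨_, h1, h2⟩
  by_cases hleg : π x = π y ∧ x ≠ v ∧ y ≠ v
  · obtain ⟨hπ, hxv, hyv⟩ := hleg
    rcases lt_trichotomy (μ x) (μ y) with hμ | hμ | hμ
    · exact key x y hπ hxv hμ
    · exact absurd (h.eq_of x y hxv hyv hπ hμ) hxy
    · obtain ⟨A, h1, h2⟩ := key y x hπ.symm hyv hμ
      exact ⟨A, h2, h1⟩
  -- For `s` from `-μ x` to `0` the path runs down the leg of `x` to the top, then for `s` up to `μ
  -- y` it climbs the leg of `y`.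
  · let γ : ℝ → X := fun s => if s ≤ 0 then h.legPoint x (-s) else h.legPoint y s
    have hx0 := h.height_nonneg x
    have hy0 := h.height_nonneg y
    have hlt : -μ x < μ y := by
      by_contra! hle
      exact hxy ((h.eq_top x (by linarith)).trans (h.eq_top y (by linarith)).symm)
    have hγ : Continuous γ := by
      refine Continuous.if_le ((h.continuous_legPoint_left x).comp continuous_neg)
        (h.continuous_legPoint_left y) continuous_id continuous_const ?_
      rintro s rfl
      simp [legPoint_zero]
    have hγ1 : ∀ s, s ≤ 0 → γ s = h.legPoint x (-s) := fun s hs => if_pos hs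
    have hγ2 : ∀ s, 0 < s → γ s = h.legPoint y s := fun s hs => if_neg hs.not_ge
    have hmix : ∀ s t, s ≤ 0 → 0 < t → -μ x ≤ s → t ≤ μ y → γ s ≠ γ t := by
      intro s t hs ht hs' ht' he
      rw [hγ1 s hs, hγ2 t ht] at he
      have hst := congrArg μ he
      rw [h.height_legPoint_of_mem ⟨by linarith, by linarith⟩,
        h.height_legPoint_of_mem ⟨ht.le, ht'⟩] at hst
      have hxv : x ≠ v := h.ne_top (by linarith)
      have hyv : y ≠ v := h.ne_top (by linarith)
      have := congrArg π he
      rw [h.leg_legPoint hxv (by linarith), h.leg_legPoint hyv ht] at this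
      exact hleg ⟨this, hxv, hyv⟩
    have hinj : InjOn γ (Icc (-μ x) (μ y)) := by
      intro s hs t ht he
      rcases le_or_gt s 0 with h1 | h1 <;> rcases le_or_gt t 0 with h2 | h2
      · rw [hγ1 s h1, hγ1 t h2] at he
        have := h.injOn_legPoint x ⟨by linarith, by linarith [hs.1]⟩
          ⟨by linarith, by linarith [ht.1]⟩ he
        linarith
      · exact absurd he (hmix s t h1 h2 hs.1 ht.2)
      · exact absurd he.symm (hmix t s h2 h1 ht.1 hs.2)
      · rw [hγ2 s h1, hγ2 t h2] at he
        exact h.injOn_legPoint y ⟨h1.le, hs.2⟩ ⟨h2.le, ht.2⟩ he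
    obtain ⟨h1, h2⟩ := isArcEndpoint_image_Icc hlt hγ.continuousOn hinj
    rw [hγ1 _ (by linarith), neg_neg, h.legPoint_height] at h1
    have hγy : γ (μ y) = y := by
      rcases hy0.eq_or_lt with h3 | h3
      · rw [← h3, hγ1 0 le_rfl, neg_zero, legPoint_zero, h.eq_top y h3.symm]
      · rw [hγ2 _ h3, h.legPoint_height]
    rw [hγy] at h2
    exact ⟨_, h1, h2⟩

theorem isDendroid [CompactSpace X] [MetrizableSpace X] (h : FanChart v μ π) : IsDendroid X :=
  ⟨⟨h.connectedSpace, inferInstance, inferInstance⟩, h.isArcwiseConnected,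
    h.isHereditarilyUnicoherent⟩

/-- A continuum issuing from `x ≠ v` contains a segment of the leg of `x` just above or just
below `x`. -/
theorem exists_segment [CompactSpace X] [T2Space X] (h : FanChart v μ π) {J : Set X}
    (hc : IsClosed J) (hJ : IsPreconnected J) {x a : X} (hx : x ∈ J) (ha : a ∈ J) (hax : a ≠ x)
    (hxv : x ≠ v) :
    (∃ w, π w = π x ∧ μ x < μ w ∧ ∀ z, π z = π x → μ x < μ z → μ z ≤ μ w → z ∈ J) ∨
      ∃ s, 0 ≤ s ∧ s < μ x ∧ ∀ z, π z = π x → s < μ z → μ z < μ x → z ∈ J := by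
  have hx0 := h.pos hxv
  by_cases hav : a ≠ v ∧ π a = π x
  · rcases lt_trichotomy (μ a) (μ x) with hμ | hμ | hμ
    · refine Or.inr ⟨μ a, h.height_nonneg a, hμ, fun z hz h1 h2 => ?_⟩
      exact h.mem_of_isPreconnected hc hJ hx ha (h.ne_top ((h.height_nonneg a).trans_lt h1)) hz h2
        fun _ _ => h1.le
    · exact absurd (h.eq_of a x hav.1 hxv hav.2 hμ) hax
    · refine Or.inl ⟨a, hav.2, hμ, fun z hz h1 h2 => ?_⟩
      have hzv := h.ne_top (hx0.trans h1)
      rcases h2.eq_or_lt with h2 | h2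
      · rwa [h.eq_of z a hzv hav.1 (hz.trans hav.2.symm) h2]
      · exact h.mem_of_isPreconnected hc hJ ha hx hzv (hz.trans hav.2.symm) h2 fun _ _ => h1.le
  · refine Or.inr ⟨0, le_rfl, hx0, fun z hz h1 h2 => ?_⟩
    exact h.mem_of_isPreconnected hc hJ hx ha (h.ne_top h1) hz h2
      fun h3 h4 => absurd ⟨h3, h4⟩ hav

theorem exists_common_of_above {Y : Type*} {μ : Y → ℝ} {π : Y → ℕ → Bool} {J J' : Set Y} {x : Y}
    (hJ : ∃ w, π w = π x ∧ μ x < μ w ∧ ∀ z, π z = π x → μ x < μ z → μ z ≤ μ w → z ∈ J)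
    (hJ' : ∃ w, π w = π x ∧ μ x < μ w ∧ ∀ z, π z = π x → μ x < μ z → μ z ≤ μ w → z ∈ J') :
    ∃ z ∈ J ∩ J', z ≠ x := by
  obtain ⟨w, h1, h2, h3⟩ := hJ
  obtain ⟨w', h1', h2', h3'⟩ := hJ'
  rcases le_total (μ w) (μ w') with hle | hle
  · exact ⟨w, ⟨h3 w h1 h2 le_rfl, h3' w h1 h2 hle⟩, by rintro rfl; exact lt_irrefl _ h2⟩
  · exact ⟨w', ⟨h3 w' h1' h2' hle, h3' w' h1' h2' le_rfl⟩, by rintro rfl; exact lt_irrefl _ h2'⟩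

theorem exists_common_of_below (h : FanChart v μ π) {J J' : Set X} {x : X}
    (hJ : ∃ s, 0 ≤ s ∧ s < μ x ∧ ∀ z, π z = π x → s < μ z → μ z < μ x → z ∈ J)
    (hJ' : ∃ s, 0 ≤ s ∧ s < μ x ∧ ∀ z, π z = π x → s < μ z → μ z < μ x → z ∈ J') :
    ∃ z ∈ J ∩ J', z ≠ x := by
  obtain ⟨s, h1, h2, h3⟩ := hJ
  obtain ⟨s', h1', h2', h3'⟩ := hJ'
  obtain ⟨t, ht, ht'⟩ := exists_between (max_lt h2 h2')
  obtain ⟨hs, hs'⟩ := max_lt_iff.1 ht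
  obtain ⟨z, hz, rfl⟩ := h.exists_below x t (h1.trans_lt hs) ht'.le
  exact ⟨z, ⟨h3 z hz hs ht', h3' z hz hs' ht'⟩, by rintro rfl; exact lt_irrefl _ ht'⟩

/-- Off the top there are only two directions, up and down the leg. Two of the three legs of a triod
would leave its top in the same direction and share a further point. -/
theorem ramificationPoints_subset [CompactSpace X] [T2Space X] (h : FanChart v μ π) :
    ramificationPoints X ⊆ {v} := by
  rintro x ⟨T, hT⟩
  by_contra hxv
  obtain ⟨J, hJ, hd⟩ := hT.exists_legs
  have hseg : ∀ i, _ := fun i => h.exists_segment (hJ i).1.isClosed (hJ i).2.1 (hJ i).2.2.1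
    (hJ i).2.2.2.choose_spec.1 (hJ i).2.2.2.choose_spec.2 hxv
  have hno : ∀ i j, i ≠ j → ¬ ∃ z ∈ J i ∩ J j, z ≠ x := by
    rintro i j hij ⟨z, hz, hzx⟩
    exact hzx (hd i j hij hz)
  have hA := fun i j (hij : i ≠ j) h1 h2 =>
    hno i j hij (exists_common_of_above (μ := μ) (π := π) (J := J i) (J' := J j) (x := x) h1 h2)
  have hB := fun i j (hij : i ≠ j) h1 h2 =>
    hno i j hij (h.exists_common_of_below (J := J i) (J' := J j) (x := x) h1 h2)
  rcases hseg 0 with h0 | h0 <;> rcases hseg 1 with h1 | h1 <;> rcases hseg 2 with h2 | h2 <;>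
    first
      | exact hA 0 1 (by decide) h0 h1
      | exact hA 0 2 (by decide) h0 h2
      | exact hA 1 2 (by decide) h1 h2
      | exact hB 0 1 (by decide) h0 h1
      | exact hB 0 2 (by decide) h0 h2
      | exact hB 1 2 (by decide) h1 h2

theorem top_mem_ramificationPoints [CompactSpace X] [T2Space X] (h : FanChart v μ π)
    (x : Fin 3 → X) (hx : ∀ i, x i ≠ v) (hπ : ∀ i j, i ≠ j → π (x i) ≠ π (x j)) :
    v ∈ ramificationPoints X := by
  have hmem : ∀ i, ∀ s : unitInterval, (s : ℝ) * μ (x i) ∈ Icc 0 (μ (x i)) := fun i s =>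
    ⟨mul_nonneg s.2.1 (h.pos (hx i)).le, mul_le_of_le_one_left (h.pos (hx i)).le s.2.2⟩
  refine exists_isTriodTop (γ := fun i s => h.legPoint (x i) (s * μ (x i)))
    (fun i => (h.continuous_legPoint_left (x i)).comp (by fun_prop)) ?_ ?_ ?_
  · intro i s t hst
    have := h.injOn_legPoint (x i) (hmem i s) (hmem i t) hst
    exact Subtype.ext (mul_right_cancel₀ (h.pos (hx i)).ne' this)
  · intro i
    simp [legPoint_zero]
  · intro i j s t hij hst
    by_contra hs
    have hs0 : 0 < (s : ℝ) * μ (x i) :=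
      mul_pos (s.2.1.lt_of_ne fun h0 => hs (Subtype.ext h0.symm)) (h.pos (hx i))
    have hμ := congrArg μ hst
    simp only [h.height_legPoint_of_mem (hmem _ _)] at hμ
    have hl := congrArg π hst
    simp only [h.leg_legPoint (hx i) hs0, h.leg_legPoint (hx j) (hμ ▸ hs0)] at hl
    exact hπ i j hij hl

/-- The arc is leg-convex, so it contains the leg segment. That segment is a connected part of the
arc containing both of its ends, hence all of it. -/
theorem isArcFromTo_eq [CompactSpace X] [T2Space X] (h : FanChart v μ π) {A : Set X} {x : X}
    (hA : IsArcFromTo A v x) : A = h.legPoint x '' Icc 0 (μ x) := by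
  rcases hA with ⟨rfl, rfl⟩ | ⟨hvx, hv, hx⟩
  · simp [h.height_top, legPoint_zero]
  · obtain ⟨γ, hγ, hi, rfl, rfl, rfl⟩ := exists_param_of_isArcEndpoint hvx hv hx
    have hsub : h.legPoint (γ 1) '' Icc 0 (μ (γ 1)) ⊆ range γ :=
      h.image_legPoint_zero_subset (h.legConvex (isCompact_range hγ).isClosed
        (isPreconnected_range hγ)) (mem_range_self _) (mem_range_self _)
    refine Subset.antisymm ?_ hsub
    have := image_Icc_subset_of_isPreconnected hγ hi (s := 0) (t := 1)
      ((inter_eq_left.2 hsub).symm ▸ h.isPreconnected_image_legPoint _ _ _)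
      (show γ 0 ∈ h.legPoint (γ 1) '' Icc 0 (μ (γ 1)) from
        ⟨0, ⟨le_rfl, h.height_nonneg _⟩, h.legPoint_zero _⟩)
      ⟨_, ⟨h.height_nonneg _, le_rfl⟩, h.legPoint_height _⟩
    refine Subset.trans ?_ this
    rintro _ ⟨t, rfl⟩
    exact ⟨t, ⟨t.2.1, t.2.2⟩, rfl⟩

theorem legPoint_mem (h : FanChart v μ π) (x : X) {t : ℝ} (ht : 0 ≤ t) :
    h.legPoint x t ∈ h.legPoint x '' Icc 0 (μ x) := by
  rcases le_or_gt t (μ x) with h1 | h1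
  · exact ⟨t, ⟨ht, h1⟩, rfl⟩
  · refine ⟨μ x, ⟨h.height_nonneg x, le_rfl⟩, ?_⟩
    unfold legPoint
    by_cases hx : 0 < μ x
    · simp only [hx, hx.trans h1, and_self, dif_pos, min_self, min_eq_right h1.le]
    · simp [hx]

theorem isSmoothFan [CompactSpace X] [MetrizableSpace X] (h : FanChart v μ π)
    (hv : v ∈ ramificationPoints X) : IsSmoothFan X := by
  refine ⟨⟨h.isDendroid, subsingleton_singleton.anti h.ramificationPoints_subset⟩, v, hv, ?_⟩
  intro x u hu A B hA hB
  -- Since `legPoint` truncates its parameter, the one compact interval `[0, M]` parametrizes all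
  -- arcs from the top, and a tube argument over it treats the Vietoris condition of inclusion in an
  -- open set.
  obtain ⟨M, hM⟩ : ∃ M, ∀ x, μ x ≤ M := by
    obtain ⟨M, hM⟩ := (isCompact_range h.continuous_height).bddAbove
    exact ⟨M, fun x => hM (mem_range_self x)⟩
  let : TopologicalSpace (Set X) := TopologicalSpace.vietoris X
  rw [NonemptyCompacts.isEmbedding_coe.isInducing.nhds_eq_comap, tendsto_comap_iff,
    tendsto_nhds_generateFrom_iff]
  rintro _ (⟨U, hU, rfl⟩ | ⟨U, hU, rfl⟩) hBU
  · have hBU' : (B : Set X) ⊆ U := hBU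
    have hev : ∀ᶠ y in 𝓝 x, ∀ t ∈ Icc 0 M, h.legPoint y t ∈ U := by
      refine isCompact_Icc.eventually_forall_of_forall_eventually fun t ht => ?_
      refine (h.continuous_legPoint.tendsto (x, t)).eventually (hU.mem_nhds (hBU' ?_))
      rw [h.isArcFromTo_eq hB]
      exact h.legPoint_mem x ht.1
    filter_upwards [hu.eventually hev] with n hn
    change (A n : Set X) ⊆ U
    rw [h.isArcFromTo_eq (hA n)]
    rintro _ ⟨t, ht, rfl⟩
    exact hn t ⟨ht.1, ht.2.trans (hM _)⟩
  · obtain ⟨z, hzB, hzU⟩ : ((B : Set X) ∩ U).Nonempty := hBU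
    rw [h.isArcFromTo_eq hB] at hzB
    obtain ⟨t, ht, rfl⟩ := hzB
    have hc : Continuous fun y => h.legPoint y t :=
      h.continuous_legPoint.comp (by fun_prop : Continuous fun y : X => (y, t))
    filter_upwards [hu.eventually ((hc.tendsto x).eventually (hU.mem_nhds hzU))] with n hn
    refine ⟨_, ?_, hn⟩
    change _ ∈ (A n : Set X)
    rw [h.isArcFromTo_eq (hA n)]
    exact h.legPoint_mem _ ht.1

/-- If `x` were interior to an arc, both halves of the arc would have to leave `x` downwards and so
would meet again. -/
theorem mem_endPoints [CompactSpace X] [T2Space X] (h : FanChart v μ π) {x : X} (hxv : x ≠ v)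
    (hx : ∀ y, π y = π x → μ y ≤ μ x) : x ∈ endPoints X := by
  intro A hA hxA
  obtain ⟨γ, hγ, hi, rfl⟩ := hA.exists_param
  obtain ⟨s, rfl⟩ := hxA
  by_cases h0 : s = 0
  · exact h0 ▸ isArcEndpoint_range_zero hγ hi
  by_cases h1 : s = 1
  · exact h1 ▸ isArcEndpoint_range_one hγ hi
  exfalso
  have hclosed : ∀ a b, IsClosed (γ '' Icc a b) := fun a b =>
    (isCompact_Icc.image hγ).isClosed
  have hconn : ∀ a b, IsPreconnected (γ '' Icc a b) := fun a b =>
    isPreconnected_Icc.image _ hγ.continuousOn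
  have hbelow : ∀ {J : Set X}, IsClosed J → IsPreconnected J → γ s ∈ J → ∀ a ∈ J, a ≠ γ s →
      ∃ t, 0 ≤ t ∧ t < μ (γ s) ∧ ∀ z, π z = π (γ s) → t < μ z → μ z < μ (γ s) → z ∈ J := by
    intro J hc hJ hs a ha hne
    refine (h.exists_segment hc hJ hs ha hne hxv).resolve_left ?_
    rintro ⟨w, h1, h2, -⟩
    exact (hx w h1).not_gt h2
  obtain ⟨z, ⟨⟨a, ha, rfl⟩, ⟨b, hb, hab⟩⟩, hz⟩ := h.exists_common_of_below
    (hbelow (hclosed 0 s) (hconn 0 s) ⟨s, ⟨s.2.1, le_rfl⟩, rfl⟩ (γ 0) ⟨0, ⟨le_rfl, s.2.1⟩, rfl⟩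
      fun he => h0 (hi he).symm)
    (hbelow (hclosed s 1) (hconn s 1) ⟨s, ⟨le_rfl, s.2.2⟩, rfl⟩ (γ 1) ⟨1, ⟨s.2.2, le_rfl⟩, rfl⟩
      fun he => h1 (hi he).symm)
  rw [hi hab] at hb
  exact hz (congrArg γ (le_antisymm ha.2 hb.1))

/-- A higher point of the leg would put `x` in the interior of the arc from the top to that point.
-/
theorem height_le_of_mem_endPoints [CompactSpace X] [T2Space X] (h : FanChart v μ π) {x y : X}
    (hxv : x ≠ v) (hx : x ∈ endPoints X) (hy : π y = π x) : μ y ≤ μ x := by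
  by_contra! hlt
  have hx0 := h.pos hxv
  have hy0 := hx0.trans hlt
  let γ : unitInterval → X := fun s => h.legPoint y (s * μ y)
  have hmem : ∀ s : unitInterval, (s : ℝ) * μ y ∈ Icc 0 (μ y) := fun s =>
    ⟨mul_nonneg s.2.1 hy0.le, mul_le_of_le_one_left hy0.le s.2.2⟩
  have hγ : Continuous γ := (h.continuous_legPoint_left y).comp (by fun_prop)
  have hi : Function.Injective γ := fun s t hst =>
    Subtype.ext (mul_right_cancel₀ hy0.ne' (h.injOn_legPoint y (hmem s) (hmem t) hst))
  let s : unitInterval := ⟨μ x / μ y, by positivity, (div_le_one hy0).2 hlt.le⟩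
  have hs : γ s = x := by
    simp only [γ, s]
    rw [div_mul_cancel₀ _ hy0.ne', h.legPoint_eq hxv hy.symm hlt.le]
  have hend := hx (range γ) (isArcEndpoint_range_zero hγ hi).isArc ⟨s, hs⟩
  rw [← hs] at hend
  rcases hend.eq_zero_or_one hγ hi with h0 | h0 <;> have h1 := congrArg Subtype.val h0 <;>
    simp only [s, Set.Icc.coe_zero, Set.Icc.coe_one] at h1
  · exact (div_pos hx0 hy0).ne' h1
  · exact ((div_lt_one hy0).2 hlt).ne h1

end FanChart
end Charts

/-! ### From smooth fans to charts: the order given by the arcs from the top. -/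

theorem continuous_of_isClosed_graph {Y Z : Type*} [TopologicalSpace Y] [TopologicalSpace Z]
    [CompactSpace Z] {f : Y → Z} (hf : IsClosed {p : Y × Z | p.2 = f p.1}) : Continuous f := by
  refine continuous_iff_isClosed.2 fun C hC => ?_
  have := isClosedMap_fst_of_compactSpace _ (hf.inter (hC.preimage continuous_snd))
  convert this
  ext y
  constructor
  · intro hy
    exact ⟨(y, f y), ⟨rfl, hy⟩, rfl⟩
  · rintro ⟨⟨y', z⟩, ⟨h1, h2⟩, rfl⟩
    simp only [mem_ofPred_eq, mem_preimage] at h1 h2 ⊢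
    exact h1 ▸ h2

/-- Disjoint closed parts of a compact totally disconnected set are separated by a relatively
clopen part. -/
theorem exists_relClopen_of_isTotallyDisconnected {X : Type*} [TopologicalSpace X] [T2Space X]
    {L S T : Set X} (hL : IsCompact L) (hd : IsTotallyDisconnected L) (hS : IsClosed S)
    (hT : IsClosed T) (hST : Disjoint S T) (hSL : S ⊆ L) :
    ∃ K ⊆ L, IsClosed K ∧ IsClosed (L \ K) ∧ S ⊆ K ∧ Disjoint T K := by
  have : CompactSpace L := isCompact_iff_compactSpace.1 hL
  have : TotallyDisconnectedSpace L := totallyDisconnectedSpace_subtype_iff.2 hd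
  obtain ⟨C, hC, h1, h2⟩ := exists_clopen_of_closed_subset_open
    (hS.preimage continuous_subtype_val : IsClosed ((↑) ⁻¹' S : Set L))
    (hT.preimage continuous_subtype_val : IsClosed ((↑) ⁻¹' T : Set L)).isOpen_compl
    (fun x hx hx' => disjoint_left.1 hST hx hx')
  refine ⟨(↑) '' C, Subtype.coe_image_subset _ _,
    (hC.isClosed.isCompact.image continuous_subtype_val).isClosed, ?_, ?_, ?_⟩
  · have : L \ ((↑) '' C) = ((↑) '' Cᶜ : Set X) := by
      ext x
      simp only [Set.mem_sdiff, mem_image, Subtype.exists, exists_and_right, exists_eq_right,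
        mem_compl_iff]
      grind
    rw [this]
    exact (hC.compl.isClosed.isCompact.image continuous_subtype_val).isClosed
  · intro x hx
    exact ⟨⟨x, hSL hx⟩, h1 hx, rfl⟩
  · rw [disjoint_left]
    rintro _ hx ⟨y, hy, rfl⟩
    exact h2 hy hx

theorem IsHereditarilyUnicoherent.isConnected_inter {X : Type*} [TopologicalSpace X]
    (hu : IsHereditarilyUnicoherent X) {A B : Set X} (hA : IsSubcontinuum A)
    (hB : IsSubcontinuum B) (hAB : (A ∩ B).Nonempty) : IsConnected (A ∩ B) :=
  hu (A ∪ B) ⟨hA.1.union hB.1, hA.2.union hAB hB.2⟩ A B hA hB rfl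

/-- A choice of the arcs `A[v, y]` in a hereditarily unicoherent space. -/
structure ArcSystem {X : Type*} [TopologicalSpace X] (v : X) (D : X → NonemptyCompacts X) :
    Prop where
  unicoherent : IsHereditarilyUnicoherent X
  isArcFromTo : ∀ y, IsArcFromTo (D y : Set X) v y

namespace ArcSystem

variable {X : Type*} [TopologicalSpace X] {v : X} {D : X → NonemptyCompacts X}

theorem coe_top (h : ArcSystem v D) : (D v : Set X) = {v} := by
  rcases h.isArcFromTo v with ⟨-, h⟩ | ⟨h, -⟩
  · exact h
  · exact absurd rfl h

variable [T2Space X]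

theorem exists_param (h : ArcSystem v D) {y : X} (hy : y ≠ v) :
    ∃ γ : unitInterval → X, Continuous γ ∧ Function.Injective γ ∧ range γ = D y ∧
      γ 0 = v ∧ γ 1 = y := by
  rcases h.isArcFromTo y with ⟨h, -⟩ | ⟨h, h1, h2⟩
  · exact absurd h.symm hy
  · exact exists_param_of_isArcEndpoint h h1 h2

theorem top_mem (h : ArcSystem v D) (y : X) : v ∈ (D y : Set X) := by
  by_cases hy : y = v
  · rw [hy, h.coe_top]
    rfl
  · obtain ⟨γ, -, -, hr, rfl, -⟩ := h.exists_param hy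
    exact hr ▸ mem_range_self _

theorem self_mem (h : ArcSystem v D) (y : X) : y ∈ (D y : Set X) := by
  by_cases hy : y = v
  · rw [hy, h.coe_top]
    rfl
  · obtain ⟨γ, -, -, hr, -, rfl⟩ := h.exists_param hy
    exact hr ▸ mem_range_self _

theorem isSubcontinuum (h : ArcSystem v D) (y : X) : IsSubcontinuum (D y : Set X) := by
  refine ⟨(D y).isCompact, (D y).nonempty, ?_⟩
  by_cases hy : y = v
  · rw [hy, h.coe_top]
    exact isPreconnected_singleton
  · obtain ⟨γ, hγ, -, hr, -, -⟩ := h.exists_param hy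
    exact hr ▸ isPreconnected_range hγ

/-- `A[v, y]` is the least subcontinuum containing `v` and `y`. -/
theorem subset_of_isSubcontinuum (h : ArcSystem v D) {K : Set X} (hK : IsSubcontinuum K)
    (hv : v ∈ K) {y : X} (hy : y ∈ K) : (D y : Set X) ⊆ K := by
  by_cases hyv : y = v
  · rw [hyv, h.coe_top]
    exact singleton_subset_iff.2 hv
  · obtain ⟨γ, hγ, hi, hr, rfl, rfl⟩ := h.exists_param hyv
    have hc := h.unicoherent.isConnected_inter hK (h.isSubcontinuum (γ 1)) ⟨γ 0, hv, h.top_mem _⟩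
    rw [← hr] at hc ⊢
    refine Subset.trans ?_ (image_Icc_subset_of_isPreconnected hγ hi hc.isPreconnected hv hy)
    rintro _ ⟨t, rfl⟩
    exact ⟨t, ⟨t.2.1, t.2.2⟩, rfl⟩

/-- Membership `x ∈ D y` plays the role of an order `x ≤ y`, and this is its transitivity. With
`antisymm` and `total`, each arc from `v` becomes a chain. -/
theorem subset_of_mem (h : ArcSystem v D) {x y : X} (hx : x ∈ (D y : Set X)) :
    (D x : Set X) ⊆ D y :=
  h.subset_of_isSubcontinuum (h.isSubcontinuum y) (h.top_mem y) hx

theorem coe_param (h : ArcSystem v D) {γ : unitInterval → X} (hγ : Continuous γ)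
    (hi : Function.Injective γ) (h0 : γ 0 = v) (s : unitInterval) :
    (D (γ s) : Set X) = γ '' Icc 0 s := by
  have hsub : (D (γ s) : Set X) ⊆ γ '' Icc 0 s :=
    h.subset_of_isSubcontinuum ⟨isCompact_Icc.image hγ, ⟨_, 0, ⟨le_rfl, s.2.1⟩, rfl⟩,
      isPreconnected_Icc.image _ hγ.continuousOn⟩ ⟨0, ⟨le_rfl, s.2.1⟩, h0⟩ ⟨s, ⟨s.2.1, le_rfl⟩, rfl⟩
  refine hsub.antisymm (image_Icc_subset_of_isPreconnected hγ hi ?_ (h0 ▸ h.top_mem _)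
    (h.self_mem _))
  rw [inter_eq_left.2 (hsub.trans (image_subset_range _ _))]
  exact (h.isSubcontinuum _).2.isPreconnected

theorem antisymm (h : ArcSystem v D) {x y : X} (hxy : x ∈ (D y : Set X))
    (hyx : y ∈ (D x : Set X)) : x = y := by
  by_cases hy : y = v
  · subst hy
    rw [h.coe_top] at hxy
    exact hxy
  · obtain ⟨γ, hγ, hi, hr, h0, rfl⟩ := h.exists_param hy
    rw [← hr] at hxy
    obtain ⟨s, rfl⟩ := hxy
    rw [h.coe_param hγ hi h0] at hyx
    obtain ⟨t, ht, hts⟩ := hyx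
    rw [hi hts] at ht
    exact congrArg γ (le_antisymm s.2.2 ht.2)

theorem total (h : ArcSystem v D) {a b y : X} (ha : a ∈ (D y : Set X)) (hb : b ∈ (D y : Set X)) :
    a ∈ (D b : Set X) ∨ b ∈ (D a : Set X) := by
  by_cases hy : y = v
  · subst hy
    rw [h.coe_top] at ha hb
    rw [ha, hb]
    exact Or.inl (h.top_mem _)
  · obtain ⟨γ, hγ, hi, hr, h0, rfl⟩ := h.exists_param hy
    rw [← hr] at ha hb
    obtain ⟨s, rfl⟩ := ha
    obtain ⟨t, rfl⟩ := hb
    rw [h.coe_param hγ hi h0, h.coe_param hγ hi h0]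
    rcases le_total s t with hst | hst
    · exact Or.inl ⟨s, ⟨s.2.1, hst⟩, rfl⟩
    · exact Or.inr ⟨t, ⟨t.2.1, hst⟩, rfl⟩

/-- If `v` is the only possible ramification point then arcs `A[v, a]` and `A[v, b]` with a common
point besides `v` are comparable. -/
theorem comparable_of_mem (h : ArcSystem v D) (hram : ramificationPoints X ⊆ {v}) {z a b : X}
    (hz : z ≠ v) (hza : z ∈ (D a : Set X)) (hzb : z ∈ (D b : Set X)) :
    a ∈ (D b : Set X) ∨ b ∈ (D a : Set X) := by
  by_contra! hab
  have hav : a ≠ v := by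
    rintro rfl
    exact hab.1 (h.top_mem b)
  have hbv : b ≠ v := by
    rintro rfl
    exact hab.2 (h.top_mem a)
  obtain ⟨γ, hγ, hi, hr, h0, rfl⟩ := h.exists_param hav
  obtain ⟨δ, hδ, hj, hs, k0, rfl⟩ := h.exists_param hbv
  have hE : IsCompact ((D (γ 1) : Set X) ∩ D (δ 1)) := (D (γ 1)).isCompact.inter (D (δ 1)).isCompact
  have hEc := h.unicoherent.isConnected_inter (h.isSubcontinuum (γ 1)) (h.isSubcontinuum (δ 1))
    ⟨v, h.top_mem _, h.top_mem _⟩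
  rw [← hr] at hza
  obtain ⟨s₁, rfl⟩ := hza
  -- `γ s` is the last point of the arc to `a` lying on the arc to `b`. If the arcs are
  -- incomparable, they branch there.
  obtain ⟨s, hsE, hsmax⟩ := (hE.isClosed.preimage hγ).isCompact.exists_isGreatest
    ⟨s₁, show γ s₁ ∈ (D (γ 1) : Set X) ∩ D (δ 1) from ⟨hr ▸ mem_range_self _, hzb⟩⟩
  have hEs : (D (γ 1) : Set X) ∩ D (δ 1) = D (γ s) := by
    refine Subset.antisymm ?_ (subset_inter (h.subset_of_mem hsE.1) (h.subset_of_mem hsE.2))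
    rintro w ⟨hw1, hw2⟩
    have hw := hw1
    rw [← hr] at hw
    obtain ⟨t, rfl⟩ := hw
    rw [h.coe_param hγ hi h0]
    exact ⟨t, ⟨t.2.1, hsmax ⟨hw1, hw2⟩⟩, rfl⟩
  have hsb := hsE.2
  rw [← hs] at hsb
  obtain ⟨s', hs'⟩ := hsb
  have hspos : 0 < (s : ℝ) := by
    have h1 : (s₁ : ℝ) ≤ s := hsmax ⟨hr ▸ mem_range_self _, hzb⟩
    refine lt_of_lt_of_le (s₁.2.1.lt_of_ne fun h2 => hz ?_) h1
    rw [show s₁ = 0 from Subtype.ext h2.symm, h0]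
  have hs1 : (s : ℝ) < 1 := by
    refine s.2.2.lt_of_ne fun h2 => hab.1 ?_
    have h3 : s = 1 := Subtype.ext h2
    exact h3 ▸ hsE.2
  have hs'1 : (s' : ℝ) < 1 := by
    refine s'.2.2.lt_of_ne fun h2 => hab.2 ?_
    have h3 : s' = 1 := Subtype.ext h2
    have h4 : δ 1 = γ s := by rw [← hs', h3]
    exact h4 ▸ hsE.1
  have hup : ∀ (r t : unitInterval), (1 - (1 - r) * (1 - t) : ℝ) ∈ Icc (0 : ℝ) 1 := fun r t => by
    have h1 := r.2.1
    have h2 := r.2.2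
    have h3 := t.2.1
    have h4 := t.2.2
    constructor <;> nlinarith
  have hdn : ∀ (r t : unitInterval), (r * (1 - t) : ℝ) ∈ Icc (0 : ℝ) 1 := fun r t => by
    have h1 := r.2.1
    have h2 := r.2.2
    have h3 := t.2.1
    have h4 := t.2.2
    constructor <;> nlinarith
  -- Reparametrizations of the legs of a triod at `γ s = δ s'`: `e0` runs back to `v`, `e1` on to `a
  -- = γ 1`, `e2` on to `b = δ 1`.
  let e0 : unitInterval → unitInterval := fun t => ⟨_, hdn s t⟩
  let e1 : unitInterval → unitInterval := fun t => ⟨_, hup s t⟩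
  let e2 : unitInterval → unitInterval := fun t => ⟨_, hup s' t⟩
  have hc0 : Continuous e0 := by fun_prop
  have hc1 : Continuous e1 := by fun_prop
  have hc2 : Continuous e2 := by fun_prop
  have hi0 : Function.Injective e0 := fun t u htu => by
    have := congrArg Subtype.val htu
    have := mul_left_cancel₀ hspos.ne' this
    exact Subtype.ext (by linarith)
  have hi1 : Function.Injective e1 := fun t u htu => by
    have : (1 - (1 - s) * (1 - t) : ℝ) = 1 - (1 - s) * (1 - u) := congrArg Subtype.val htu
    have := mul_left_cancel₀ (sub_pos.2 hs1).ne' (by linarith : (1 - s : ℝ) * (1 - t) = _ * (1 - u))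
    exact Subtype.ext (by linarith)
  have hi2 : Function.Injective e2 := fun t u htu => by
    have : (1 - (1 - s') * (1 - t) : ℝ) = 1 - (1 - s') * (1 - u) := congrArg Subtype.val htu
    have := mul_left_cancel₀ (sub_pos.2 hs'1).ne'
      (by linarith : (1 - s' : ℝ) * (1 - t) = _ * (1 - u))
    exact Subtype.ext (by linarith)
  have hz0 : e0 0 = s := Subtype.ext (by simp [e0])
  have hz1 : e1 0 = s := Subtype.ext (by simp [e1])
  have hz2 : e2 0 = s' := Subtype.ext (by simp [e2])
  have hle0 : ∀ t, e0 t ≤ s := fun t => by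
    have h1 := s.2.1
    have h3 := t.2.1
    change (s * (1 - t) : ℝ) ≤ s
    nlinarith
  have hge1 : ∀ t, e1 t ≤ s → t = 0 := fun t ht => by
    have ht' : (1 - (1 - s) * (1 - t) : ℝ) ≤ s := ht
    have h3 := t.2.1
    exact Subtype.ext (le_antisymm (show (t : ℝ) ≤ 0 by nlinarith) h3)
  have hge2 : ∀ t, e2 t ≤ s' → t = 0 := fun t ht => by
    have ht' : (1 - (1 - s') * (1 - t) : ℝ) ≤ s' := ht
    have h3 := t.2.1
    exact Subtype.ext (le_antisymm (show (t : ℝ) ≤ 0 by nlinarith) h3)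
  have hEγ : ∀ t, γ t ∈ (D (γ s) : Set X) → t ≤ s := fun t ht => by
    rw [h.coe_param hγ hi h0] at ht
    obtain ⟨u, hu, hut⟩ := ht
    exact hi hut ▸ hu.2
  have hEδ : ∀ t, δ t ∈ (D (γ s) : Set X) → t ≤ s' := fun t ht => by
    rw [← hs', h.coe_param hδ hj k0] at ht
    obtain ⟨u, hu, hut⟩ := ht
    exact hj hut ▸ hu.2
  have hmγ : ∀ t, t ≤ s → γ t ∈ (D (γ s) : Set X) := fun t ht => by
    rw [h.coe_param hγ hi h0]
    exact ⟨t, ⟨t.2.1, ht⟩, rfl⟩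
  have hDγ : ∀ t, γ t ∈ (D (γ 1) : Set X) := fun t => hr ▸ mem_range_self t
  have hDδ : ∀ t, δ t ∈ (D (δ 1) : Set X) := fun t => hs ▸ mem_range_self t
  have h01 : ∀ t u, γ (e0 t) = γ (e1 u) → t = 0 ∧ u = 0 := fun t u htu => by
    have htu := hi htu
    have hu := hge1 u (htu ▸ hle0 t)
    refine ⟨hi0 ?_, hu⟩
    rw [htu, hu, hz0, hz1]
  have h02 : ∀ t u, γ (e0 t) = δ (e2 u) → t = 0 ∧ u = 0 := fun t u htu => by
    have hu := hge2 u (hEδ _ (htu ▸ hmγ _ (hle0 t)))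
    refine ⟨hi0 (hi ?_), hu⟩
    rw [htu, hu, hz0, hz2, hs']
  have h12 : ∀ t u, γ (e1 t) = δ (e2 u) → t = 0 ∧ u = 0 := fun t u htu => by
    have hmem : γ (e1 t) ∈ (D (γ s) : Set X) := hEs ▸ ⟨hDγ _, htu ▸ hDδ _⟩
    exact ⟨hge1 t (hEγ _ hmem), hge2 u (hEδ _ (htu ▸ hmem))⟩
  have htop : γ s ∈ ramificationPoints X := by
    refine exists_isTriodTop (γ := ![fun t => γ (e0 t), fun t => γ (e1 t), fun t => δ (e2 t)])
      ?_ ?_ ?_ ?_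
    · intro i
      fin_cases i
      · exact hγ.comp hc0
      · exact hγ.comp hc1
      · exact hδ.comp hc2
    · intro i
      fin_cases i
      · exact hi.comp hi0
      · exact hi.comp hi1
      · exact hj.comp hi2
    · intro i
      fin_cases i
      · exact congrArg γ hz0
      · exact congrArg γ hz1
      · exact (congrArg δ hz2).trans hs'
    · intro i j t u hij htu
      fin_cases i <;> fin_cases j <;> first | exact absurd rfl hij | skip
      · exact (h01 t u htu).1
      · exact (h02 t u htu).1
      · exact (h01 u t htu.symm).2
      · exact (h12 t u htu).1
      · exact (h02 u t htu.symm).2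
      · exact (h12 u t htu.symm).2
  have hsv : γ s = γ 0 := (hram htop).trans h0.symm
  exact hspos.ne' (congrArg Subtype.val (hi hsv))

end ArcSystem

/-! ### Heights, levels and separation of legs. -/

namespace ArcSystem

variable {X : Type*} [TopologicalSpace X] {v : X} {D : X → NonemptyCompacts X}

/-- A continuous function which vanishes at `v` and increases strictly along the arcs
`A[v, y]`. -/
theorem exists_height [CompactSpace X] [MetrizableSpace X] (h : ArcSystem v D)
    (hD : Continuous D) : ∃ μ : X → ℝ, Continuous μ ∧ μ v = 0 ∧
      ∀ x y, x ∈ (D y : Set X) → x ≠ y → μ x < μ y := by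
  let : MetricSpace X := metrizableSpaceMetric X
  have : Nonempty X := ⟨v⟩
  let q := denseSeq X
  -- Longer arcs are closer to `q n`, so each term grows along arcs. Growth from `x` to `y` is
  -- strict in a term whose `q n` is close to `y` compared with the distance from `y` to `D x`.
  let F : ℕ → X → ℝ := fun n y => (1 / 2) ^ n * (dist (q n) v - Metric.infDist (q n) (D y))
  have hFc : ∀ n, Continuous (F n) := fun n =>
    continuous_const.mul (continuous_const.sub
      ((Metric.lipschitz_infDist_set (q n)).continuous.comp hD))
  have hnn : ∀ n y, 0 ≤ dist (q n) v - Metric.infDist (q n) (D y) := fun n y =>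
    sub_nonneg.2 (Metric.infDist_le_dist_of_mem (h.top_mem y))
  have hbd : ∀ n y, ‖F n y‖ ≤ (1 / 2) ^ n * Metric.diam (univ : Set X) := fun n y => by
    rw [Real.norm_of_nonneg (mul_nonneg (by positivity) (hnn n y))]
    refine mul_le_mul_of_nonneg_left ?_ (by positivity)
    have h1 := Metric.dist_le_diam_of_mem isCompact_univ.isBounded (mem_univ (q n)) (mem_univ v)
    have h2 := Metric.infDist_nonneg (x := q n) (s := (D y : Set X))
    linarith
  have hs : Summable fun n : ℕ => (1 / 2 : ℝ) ^ n * Metric.diam (univ : Set X) :=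
    summable_geometric_two.mul_right _
  have hsum : ∀ y, Summable fun n => F n y := fun y =>
    Summable.of_norm_bounded hs fun n => hbd n y
  refine ⟨fun y => ∑' n, F n y, continuous_tsum hFc hs hbd, ?_, ?_⟩
  · simp [F, h.coe_top]
  · intro x y hxy hne
    have hsub := h.subset_of_mem hxy
    have hyx : y ∉ (D x : Set X) := fun hyx => hne (h.antisymm hxy hyx)
    have hpos : 0 < Metric.infDist y (D x) :=
      ((D x).isCompact.isClosed.notMem_iff_infDist_pos (D x).nonempty).1 hyx
    obtain ⟨n, hn⟩ := (denseRange_denseSeq X).exists_dist_lt y (half_pos hpos)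
    refine Summable.tsum_lt_tsum (i := n) (fun m => ?_) ?_ (hsum x) (hsum y)
    · refine mul_le_mul_of_nonneg_left ?_ (by positivity)
      have := Metric.infDist_le_infDist_of_subset (x := q m) hsub (D x).nonempty
      linarith
    · refine mul_lt_mul_of_pos_left ?_ (by positivity)
      have h1 : Metric.infDist (q n) (D y) ≤ dist (q n) y :=
        Metric.infDist_le_dist_of_mem (h.self_mem y)
      have h2 := Metric.infDist_le_infDist_add_dist (x := y) (y := q n) (s := (D x : Set X))
      rw [dist_comm] at h1
      change dist y (q n) < _ at hn
      linarith

/-- The order given by a continuous arc system is closed. -/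
theorem isClosed_mem [T2Space X] (hD : Continuous D) :
    IsClosed {p : X × X | p.2 ∈ (D p.1 : Set X)} := by
  rw [← isOpen_compl_iff, isOpen_iff_mem_nhds]
  rintro ⟨y, z⟩ (hz : z ∉ (D y : Set X))
  obtain ⟨U, W, hU, hW, hDU, hzW, hUW⟩ := SeparatedNhds.of_isCompact_isCompact (D y).isCompact
    isCompact_singleton (disjoint_singleton_right.2 hz)
  filter_upwards [prod_mem_nhds (((NonemptyCompacts.isOpen_subsets_of_isOpen hU).preimage
    hD).mem_nhds hDU) (hW.mem_nhds (hzW rfl))] with p hp hpz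
  exact disjoint_left.1 hUW (hp.1 hpz) hp.2

end ArcSystem

/-- A continuous arc system of a fan, with a height function. -/
structure HeightSystem {X : Type*} [TopologicalSpace X] (v : X) (D : X → NonemptyCompacts X)
    (μ : X → ℝ) : Prop extends ArcSystem v D where
  continuous_arc : Continuous D
  ramification : ramificationPoints X ⊆ {v}
  continuous_height : Continuous μ
  height_top : μ v = 0
  height_lt : ∀ x y, x ∈ (D y : Set X) → x ≠ y → μ x < μ y

namespace HeightSystem

variable {X : Type*} [TopologicalSpace X] {v : X} {D : X → NonemptyCompacts X} {μ : X → ℝ}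

theorem height_le (h : HeightSystem v D μ) {x y : X} (hxy : x ∈ (D y : Set X)) : μ x ≤ μ y := by
  by_cases hne : x = y
  · rw [hne]
  · exact (h.height_lt x y hxy hne).le

theorem eq_of_height_eq (h : HeightSystem v D μ) {x y : X} (hxy : x ∈ (D y : Set X))
    (he : μ x = μ y) : x = y := by
  by_contra hne
  exact (h.height_lt x y hxy hne).ne he

variable [T2Space X]

theorem eq_of_mem (h : HeightSystem v D μ) {x x' y : X} (hx : x ∈ (D y : Set X))
    (hx' : x' ∈ (D y : Set X)) (he : μ x = μ x') : x = x' := by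
  rcases h.total hx hx' with h1 | h1
  · exact h.eq_of_height_eq h1 he
  · exact (h.eq_of_height_eq h1 he.symm).symm

theorem height_nonneg (h : HeightSystem v D μ) (x : X) : 0 ≤ μ x :=
  h.height_top ▸ h.height_le (h.top_mem x)

theorem eq_top (h : HeightSystem v D μ) {x : X} (hx : μ x = 0) : x = v :=
  (h.eq_of_height_eq (h.top_mem x) (h.height_top.trans hx.symm)).symm

theorem exists_mem_height (h : HeightSystem v D μ) (y : X) {t : ℝ} (ht : 0 ≤ t) :
    ∃ z ∈ (D y : Set X), μ z = min t (μ y) := by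
  obtain ⟨z, hz, hzt⟩ := (h.isSubcontinuum y).2.isPreconnected.intermediate_value (h.top_mem y)
    (h.self_mem y) h.continuous_height.continuousOn
    (show min t (μ y) ∈ Icc (μ v) (μ y) from
      ⟨by rw [h.height_top]; exact le_min ht (h.height_nonneg y), min_le_right _ _⟩)
  exact ⟨z, hz, hzt⟩

open Classical in
/-- The point of height `min t (μ y)` on `A[v, y]`. -/
noncomputable def proj (h : HeightSystem v D μ) (t : ℝ) (y : X) : X :=
  if ht : 0 ≤ t then (h.exists_mem_height y ht).choose else v

theorem proj_mem (h : HeightSystem v D μ) {t : ℝ} (ht : 0 ≤ t) (y : X) :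
    h.proj t y ∈ (D y : Set X) := by
  rw [proj, dif_pos ht]
  exact (h.exists_mem_height y ht).choose_spec.1

theorem height_proj (h : HeightSystem v D μ) {t : ℝ} (ht : 0 ≤ t) (y : X) :
    μ (h.proj t y) = min t (μ y) := by
  rw [proj, dif_pos ht]
  exact (h.exists_mem_height y ht).choose_spec.2

theorem height_proj_of_le (h : HeightSystem v D μ) {t : ℝ} (ht : 0 ≤ t) {y : X} (hy : t ≤ μ y) :
    μ (h.proj t y) = t := by
  rw [h.height_proj ht, min_eq_left hy]

theorem proj_proj (h : HeightSystem v D μ) {s t : ℝ} (hs : 0 ≤ s) (hst : s ≤ t) {y : X}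
    (hy : t ≤ μ y) : h.proj s (h.proj t y) = h.proj s y := by
  have ht := hs.trans hst
  refine h.eq_of_mem (h.subset_of_mem (h.proj_mem ht y) (h.proj_mem hs _)) (h.proj_mem hs y) ?_
  rw [h.height_proj hs, h.height_proj hs, h.height_proj_of_le ht hy, min_eq_left hst,
    min_eq_left (hst.trans hy)]

/-- Points off the top are on the same leg iff their arcs from the top are comparable, iff they
have the same projection to any positive height below them. -/
theorem proj_eq_proj_iff (h : HeightSystem v D μ) {x y : X} {t : ℝ} (ht : 0 < t) (hx : t ≤ μ x)
    (hy : t ≤ μ y) : h.proj t x = h.proj t y ↔ x ∈ (D y : Set X) ∨ y ∈ (D x : Set X) := by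
  constructor
  · intro he
    refine h.comparable_of_mem h.ramification (z := h.proj t x) ?_ (h.proj_mem ht.le x)
      (he ▸ h.proj_mem ht.le y)
    intro h0
    have := h.height_proj_of_le ht.le hx
    rw [h0, h.height_top] at this
    exact ht.ne this
  · have key : ∀ x y : X, t ≤ μ x → x ∈ (D y : Set X) → h.proj t x = h.proj t y := by
      intro x y hx hxy
      refine h.eq_of_mem (h.subset_of_mem hxy (h.proj_mem ht.le x)) (h.proj_mem ht.le y) ?_
      rw [h.height_proj_of_le ht.le hx, h.height_proj_of_le ht.le (hx.trans (h.height_le hxy))]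
    rintro (hxy | hxy)
    · exact key x y hx hxy
    · exact (key y x hy hxy).symm

/-- The projection is cut out by two closed conditions, lying on the arc and having height `min t (μ
y)`; a closed graph suffices in a compact space. -/
theorem continuous_proj [CompactSpace X] [MetrizableSpace X] (h : HeightSystem v D μ) {t : ℝ}
    (ht : 0 ≤ t) : Continuous (h.proj t) := by
  apply continuous_of_isClosed_graph
  have hμ := h.continuous_height
  convert (ArcSystem.isClosed_mem h.continuous_arc).inter
    (isClosed_eq (f := fun p : X × X => μ p.2) (g := fun p : X × X => min t (μ p.1))
      (by fun_prop) (by fun_prop)) using 1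
  ext ⟨y, z⟩
  constructor
  · intro hz
    obtain rfl : z = h.proj t y := hz
    exact ⟨h.proj_mem ht y, h.height_proj ht y⟩
  · rintro ⟨h1, h2⟩
    exact h.eq_of_mem h1 (h.proj_mem ht y) (h2.trans (h.height_proj ht y).symm)

/-- The level sets of the height function are totally disconnected. -/
theorem isTotallyDisconnected_level [CompactSpace X] (h : HeightSystem v D μ) (t : ℝ) :
    IsTotallyDisconnected {x | μ x = t} := by
  intro K hKt hK a ha b hb
  by_contra hab
  have hlev : closure K ⊆ {x | μ x = t} :=
    closure_minimal hKt (isClosed_eq h.continuous_height continuous_const)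
  -- By unicoherence the closure of `K` meets this union in a connected set, but the union meets the
  -- level only in `a` and `b`.
  have hE : IsSubcontinuum ((D a : Set X) ∪ D b) :=
    ⟨(D a).isCompact.union (D b).isCompact, IsConnected.union ⟨v, h.top_mem a, h.top_mem b⟩
      (h.isSubcontinuum a).2 (h.isSubcontinuum b).2⟩
  have hc := h.unicoherent.isConnected_inter
    ⟨isClosed_closure.isCompact, ⟨a, subset_closure ha⟩, hK.closure⟩ hE
    ⟨a, subset_closure ha, Or.inl (h.self_mem a)⟩
  have hμa : μ a = t := hKt ha
  have hμb : μ b = t := hKt hb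
  obtain ⟨z, -, (hz : z = a), (hz' : z = b)⟩ := isPreconnected_closed_iff.1 hc.isPreconnected
    {a} {b} isClosed_singleton isClosed_singleton (by
      rintro z ⟨hz1, hz2 | hz2⟩
      · exact Or.inl (h.eq_of_height_eq hz2 ((show μ z = t from hlev hz1).trans hμa.symm))
      · exact Or.inr (h.eq_of_height_eq hz2 ((show μ z = t from hlev hz1).trans hμb.symm)))
    ⟨a, ⟨subset_closure ha, Or.inl (h.self_mem a)⟩, rfl⟩
    ⟨b, ⟨subset_closure hb, Or.inr (h.self_mem b)⟩, rfl⟩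
  exact hab (hz.symm.trans hz')

/-- A relatively clopen part of a level extends to a relatively clopen part of a lower level. -/
theorem exists_extension [CompactSpace X] [MetrizableSpace X] (h : HeightSystem v D μ) {s t : ℝ}
    (hs : 0 < s) (hst : s ≤ t) {K : Set X} (hKt : K ⊆ {x | μ x = t}) (hK : IsClosed K)
    (hK' : IsClosed ({x | μ x = t} \ K)) :
    ∃ K' ⊆ {x | μ x = s}, IsClosed K' ∧ IsClosed ({x | μ x = s} \ K') ∧
      ∀ y, μ y = t → (y ∈ K ↔ h.proj s y ∈ K') := by
  have himg : ∀ C : Set X, IsClosed C → IsClosed (h.proj s '' C) := fun C hC =>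
    (hC.isCompact.image (h.continuous_proj hs.le)).isClosed
  -- Projection to the lower level is injective on level `t`: two points with the same projection
  -- are comparable, and comparable points of equal height coincide. So `K` and its complement in
  -- the level have disjoint closed images.
  obtain ⟨K', h1, h2, h3, h4, h5⟩ := exists_relClopen_of_isTotallyDisconnected
    (isClosed_eq h.continuous_height continuous_const : IsClosed {x | μ x = s}).isCompact
    (h.isTotallyDisconnected_level s) (himg K hK) (himg _ hK') (by
      rw [disjoint_left]
      rintro _ ⟨a, ha, rfl⟩ ⟨b, hb, hab⟩
      have ha' : μ a = t := hKt ha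
      have hb' : μ b = t := hb.1
      have : b = a := by
        rcases (h.proj_eq_proj_iff hs (hb'.symm ▸ hst) (ha'.symm ▸ hst)).1 hab with h6 | h6
        · exact h.eq_of_height_eq h6 (hb'.trans ha'.symm)
        · exact (h.eq_of_height_eq h6 (ha'.trans hb'.symm)).symm
      exact hb.2 (this ▸ ha)) (by
      rintro _ ⟨a, ha, rfl⟩
      exact h.height_proj_of_le hs.le (by rw [show μ a = t from hKt ha]; exact hst))
  refine ⟨K', h1, h2, h3, fun y hy => ⟨fun hyK => h4 ⟨y, hyK, rfl⟩, fun hyK => ?_⟩⟩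
  by_contra hyn
  exact disjoint_left.1 h5 ⟨y, ⟨hy, hyn⟩, rfl⟩ hyK

/-- Different legs are separated by a clopen union of legs. -/
theorem exists_separation [CompactSpace X] [MetrizableSpace X] (h : HeightSystem v D μ) {a b : X}
    (ha : a ≠ v) (hb : b ≠ v) (hab : ¬ (a ∈ (D b : Set X) ∨ b ∈ (D a : Set X))) :
    ∃ S : Set X, IsOpen S ∧ IsOpen ({v}ᶜ \ S) ∧ a ∈ S ∧ b ∉ S ∧
      ∀ x y, x ≠ v → y ≠ v → x ∈ (D y : Set X) → (x ∈ S ↔ y ∈ S) := by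
  have hpos : ∀ {x : X}, x ≠ v → 0 < μ x := fun {x} hx =>
    (h.height_nonneg x).lt_of_ne fun h0 => hx (h.eq_top h0.symm)
  let t₀ := min (μ a) (μ b)
  have ht₀ : 0 < t₀ := lt_min (hpos ha) (hpos hb)
  -- Levels descending to `0`, starting at a height which both legs reach. A clopen part of level `τ
  -- 0` separating `a` from `b` is extended downwards to compatible clopen parts `K n` of all these
  -- levels.
  let τ : ℕ → ℝ := fun n => t₀ * (1 / ((n : ℝ) + 1))
  have hτ0 : ∀ n, 0 < τ n := fun n => by positivity
  have hτanti : ∀ n, τ (n + 1) ≤ τ n := fun n => by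
    refine mul_le_mul_of_nonneg_left ?_ ht₀.le
    exact one_div_le_one_div_of_le (by positivity) (by push_cast; linarith)
  have hτm : Antitone τ := antitone_nat_of_succ_le hτanti
  have hτlim : Tendsto τ atTop (𝓝 0) := by
    have := (tendsto_one_div_add_atTop_nhds_zero_nat (𝕜 := ℝ)).const_mul t₀
    rwa [mul_zero] at this
  have hτz : τ 0 = t₀ := by simp [τ]
  have hτa : τ 0 ≤ μ a := hτz ▸ min_le_left _ _
  have hτb : τ 0 ≤ μ b := hτz ▸ min_le_right _ _
  let L : ℕ → Set X := fun n => {x | μ x = τ n}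
  let Good : ℕ → Set X → Prop := fun n K => K ⊆ L n ∧ IsClosed K ∧ IsClosed (L n \ K)
  obtain ⟨K₀, hK1, hK2, hK3, hK4, hK5⟩ := exists_relClopen_of_isTotallyDisconnected
    (isClosed_eq h.continuous_height continuous_const : IsClosed (L 0)).isCompact
    (h.isTotallyDisconnected_level (τ 0))
    (isClosed_singleton (x := h.proj (τ 0) a)) (isClosed_singleton (x := h.proj (τ 0) b)) (by
      rw [disjoint_singleton]
      exact fun he => hab ((h.proj_eq_proj_iff (hτ0 0) hτa hτb).1 he))
    (by rintro _ rfl; exact h.height_proj_of_le (hτ0 0).le hτa)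
  have hstep : ∀ n (K : Set X), Good n K → ∃ K', Good (n + 1) K' ∧
      ∀ y, μ y = τ n → (y ∈ K ↔ h.proj (τ (n + 1)) y ∈ K') := by
    rintro n K ⟨h1, h2, h3⟩
    obtain ⟨K', h4, h5, h6, h7⟩ := h.exists_extension (hτ0 (n + 1)) (hτanti n) h1 h2 h3
    exact ⟨K', ⟨h4, h5, h6⟩, h7⟩
  choose! nxt hn1 hn2 using hstep
  let K : ℕ → Set X := fun n => Nat.rec K₀ nxt n
  have hK : ∀ n, Good n (K n) := fun n => by
    induction n with
    | zero => exact ⟨hK1, hK2, hK3⟩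
    | succ n ih => exact hn1 n _ ih
  have hKs : ∀ n y, μ y = τ n → (y ∈ K n ↔ h.proj (τ (n + 1)) y ∈ K (n + 1)) := fun n y hy =>
    hn2 n _ (hK n) y hy
  have hKle : ∀ n m, n ≤ m → ∀ y, τ n ≤ μ y →
      (h.proj (τ n) y ∈ K n ↔ h.proj (τ m) y ∈ K m) := by
    intro n m hnm y hy
    induction m, hnm using Nat.le_induction with
    | base => rfl
    | succ m hnm ih =>
      have hy' : τ m ≤ μ y := (hτm hnm).trans hy
      rw [ih, hKs m _ (h.height_proj_of_le (hτ0 m).le hy'),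
        h.proj_proj (hτ0 _).le (hτanti m) hy']
  have hKeq : ∀ n m y, τ n ≤ μ y → τ m ≤ μ y →
      (h.proj (τ n) y ∈ K n ↔ h.proj (τ m) y ∈ K m) := by
    intro n m y hn hm
    rcases le_total n m with hnm | hnm
    · exact hKle n m hnm y hn
    · exact (hKle m n hnm y hm).symm
  have hex : ∀ y, y ≠ v → ∃ n, τ n < μ y := fun y hy =>
    ((tendsto_order.1 hτlim).2 _ (hpos hy)).exists
  have hopen : ∀ n, IsOpen {y | τ n < μ y} := fun n =>
    isOpen_lt continuous_const h.continuous_height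
  -- The separating set collects the points projecting into some `K n`. Using the complement of the
  -- closed set `L n \ K n` instead of `K n` makes openness visible; above height `τ n` the two
  -- conditions agree.
  refine ⟨⋃ n, {y | τ n < μ y} ∩ (h.proj (τ n) ⁻¹' (L n \ K n))ᶜ, ?_, ?_, ?_, ?_, ?_⟩
  · exact isOpen_iUnion fun n => (hopen n).inter
      ((hK n).2.2.preimage (h.continuous_proj (hτ0 n).le)).isOpen_compl
  · have : {v}ᶜ \ (⋃ n, {y | τ n < μ y} ∩ (h.proj (τ n) ⁻¹' (L n \ K n))ᶜ) =
        ⋃ n, {y | τ n < μ y} ∩ (h.proj (τ n) ⁻¹' K n)ᶜ := by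
      ext y
      simp only [Set.mem_sdiff, mem_iUnion, mem_inter_iff, mem_compl_iff, mem_preimage,
        mem_singleton_iff, mem_ofPred_eq, not_exists, not_and, not_not]
      constructor
      · rintro ⟨hy, hn⟩
        obtain ⟨n, hlt⟩ := hex y hy
        exact ⟨n, hlt, fun hc => hn n hlt fun _ => hc⟩
      · rintro ⟨n, hlt, hn⟩
        refine ⟨?_, fun m hm hc => hn ?_⟩
        · rintro rfl
          exact ((hτ0 n).trans hlt).ne' h.height_top
        · exact (hKeq m n y hm.le hlt.le).1 (hc (h.height_proj_of_le (hτ0 m).le hm.le))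
    rw [this]
    exact isOpen_iUnion fun n => (hopen n).inter
      ((hK n).2.1.preimage (h.continuous_proj (hτ0 n).le)).isOpen_compl
  · obtain ⟨n, hn⟩ := hex a ha
    refine mem_iUnion.2 ⟨n, hn, fun hc => hc.2 ?_⟩
    exact (hKeq 0 n a hτa hn.le).1 (hK4 rfl)
  · rintro hc
    obtain ⟨n, hn, hc⟩ := mem_iUnion.1 hc
    refine hc ⟨h.height_proj_of_le (hτ0 n).le (le_of_lt hn), fun hm => ?_⟩
    exact disjoint_left.1 hK5 rfl ((hKeq 0 n b hτb (le_of_lt hn)).2 hm)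
  · intro x y hx hy hxy
    simp only [mem_iUnion, mem_inter_iff, mem_compl_iff, mem_preimage, Set.mem_sdiff,
      mem_ofPred_eq, not_and, not_not]
    obtain ⟨m, hm⟩ := hex x hx
    have hmy := hm.trans_le (h.height_le hxy)
    have hproj : h.proj (τ m) x = h.proj (τ m) y :=
      (h.proj_eq_proj_iff (hτ0 m) hm.le hmy.le).2 (Or.inl hxy)
    have hiff : ∀ z, τ m < μ z → ((∃ n, τ n < μ z ∧
        (h.proj (τ n) z ∈ L n → h.proj (τ n) z ∈ K n)) ↔ h.proj (τ m) z ∈ K m) := by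
      intro z hz
      constructor
      · rintro ⟨n, hn, hc⟩
        exact (hKeq n m z hn.le hz.le).1 (hc (h.height_proj_of_le (hτ0 n).le hn.le))
      · exact fun hc => ⟨m, hz, fun _ => hc⟩
    rw [hiff x hm, hiff y hmy, hproj]

/-- The products of a separating set with its complement off the top form an open cover of the pairs
of points on different legs. A countable subcover exists, and membership in its sets is the code. -/
theorem exists_chart [CompactSpace X] [MetrizableSpace X] (h : HeightSystem v D μ) :
    ∃ π : X → ℕ → Bool, FanChart v μ π := by
  classical
  let W := {p : X × X // p.1 ≠ v ∧ p.2 ≠ v ∧ ¬ (p.1 ∈ (D p.2 : Set X) ∨ p.2 ∈ (D p.1 : Set X))}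
  have hsep := fun p : W => h.exists_separation p.2.1 p.2.2.1 p.2.2.2
  choose S hS1 hS2 hS3 hS4 hS5 using hsep
  obtain ⟨T, hTc, hT⟩ := isOpen_iUnion_countable (fun p : W => S p ×ˢ ({v}ᶜ \ S p))
    fun p => (hS1 p).prod (hS2 p)
  -- The empty set is added so that the family can be enumerated by `ℕ` even if there is only one
  -- leg.
  let 𝒮 : Set (Set X) := insert ∅ (S '' T)
  have h𝒮 : ∀ G ∈ 𝒮, IsOpen G ∧ IsOpen ({v}ᶜ \ G) ∧
      ∀ x y, x ≠ v → y ≠ v → x ∈ (D y : Set X) → (x ∈ G ↔ y ∈ G) := by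
    rintro G (rfl | ⟨p, -, rfl⟩)
    · simp
    · exact ⟨hS1 p, hS2 p, hS5 p⟩
  obtain ⟨G, hG⟩ : ∃ G : ℕ → Set X, 𝒮 = range G :=
    ((hTc.image S).insert ∅).exists_eq_range (insert_nonempty _ _)
  have hG' : ∀ n, _ := fun n => h𝒮 (G n) (hG ▸ mem_range_self n)
  let π : X → ℕ → Bool := fun x n => decide (x ∈ G n)
  have hπ : ∀ x y, x ≠ v → y ≠ v →
      (π x = π y ↔ (x ∈ (D y : Set X) ∨ y ∈ (D x : Set X))) := by
    intro x y hx hy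
    constructor
    · intro he
      by_contra hxy
      have hmem : (x, y) ∈ ⋃ p : W, S p ×ˢ ({v}ᶜ \ S p) :=
        mem_iUnion.2 ⟨⟨(x, y), hx, hy, hxy⟩, hS3 _, hy, hS4 ⟨(x, y), hx, hy, hxy⟩⟩
      rw [← hT] at hmem
      obtain ⟨p, hp, hxp, hyp⟩ := mem_iUnion₂.1 hmem
      obtain ⟨n, hn⟩ : S p ∈ range G := hG ▸ Or.inr ⟨p, hp, rfl⟩
      have := congrFun he n
      simp only [π, hn, decide_eq_decide] at this
      exact hyp.2 (this.1 hxp)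
    · rintro (hxy | hxy)
      · funext n
        simpa [π] using (hG' n).2.2 x y hx hy hxy
      · funext n
        simpa [π] using ((hG' n).2.2 y x hy hx hxy).symm
  refine ⟨π, h.continuous_height, h.height_nonneg, h.height_top, fun x hx => h.eq_top hx, ?_, ?_,
    ?_⟩
  · refine continuousOn_pi.2 fun n x hx => ContinuousAt.continuousWithinAt ?_
    by_cases hxn : x ∈ G n
    · refine (continuousAt_const (y := true)).congr ?_
      filter_upwards [(hG' n).1.mem_nhds hxn] with y hy
      simp [π, hy]
    · refine (continuousAt_const (y := false)).congr ?_
      filter_upwards [(hG' n).2.1.mem_nhds ⟨hx, hxn⟩] with y hy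
      simp [π, hy.2]
  · intro x y hx hy he hμ
    rcases (hπ x y hx hy).1 he with hxy | hxy
    · exact h.eq_of_height_eq hxy hμ
    · exact (h.eq_of_height_eq hxy hμ.symm).symm
  · intro x t ht htx
    have hm := h.height_proj_of_le ht.le htx
    have hne : ∀ {z : X}, 0 < μ z → z ≠ v := by
      rintro _ hz rfl
      exact hz.ne' h.height_top
    exact ⟨h.proj t x, (hπ _ _ (hne (by rwa [hm])) (hne (ht.trans_le htx))).2
      (Or.inl (h.proj_mem ht.le x)), hm⟩

end HeightSystem

/-- Every smooth fan has a fan chart. -/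
theorem IsSmoothFan.exists_chart {X : Type*} [TopologicalSpace X] [CompactSpace X]
    [MetrizableSpace X] (h : IsSmoothFan X) :
    ∃ v ∈ ramificationPoints X, ∃ μ : X → ℝ, ∃ π : X → ℕ → Bool, FanChart v μ π := by
  obtain ⟨⟨⟨-, harc, hu⟩, hsub⟩, v, hv, hsm⟩ := h
  have hex : ∀ y, ∃ A : NonemptyCompacts X, IsArcFromTo (A : Set X) v y := by
    intro y
    by_cases hy : v = y
    · exact ⟨{v}, Or.inl ⟨hy, by simp⟩⟩
    · obtain ⟨A, h1, h2⟩ := harc v y hy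
      obtain ⟨γ, hγ, -, hr, h0⟩ := h1.exists_param
      refine ⟨⟨⟨A, hr ▸ isCompact_range hγ⟩, ⟨v, ?_⟩⟩, Or.inr ⟨hy, h1, h2⟩⟩
      change v ∈ A
      rw [← hr, ← h0]
      exact mem_range_self _
  choose D hD using hex
  -- Smoothness is sequential continuity of `D`, which is enough in a metrizable space.
  have hDc : Continuous D := SeqContinuous.continuous fun u x hux =>
    hsm x u hux (fun n => D (u n)) (D x) (fun n => hD _) (hD x)
  have hA : ArcSystem v D := ⟨hu, hD⟩
  obtain ⟨μ, h1, h2, h3⟩ := hA.exists_height hDc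
  exact ⟨v, hv, μ, HeightSystem.exists_chart
    ⟨hA, hDc, fun x hx => hsub hx hv, h1, h2, h3⟩⟩

/-- A Lelek function: a non-negative upper semicontinuous function on a zero-dimensional space
which, on every non-empty clopen set, is not identically zero and has a dense set of values
below each of its values. -/
structure LelekFunction {C : Type*} [TopologicalSpace C] (f : C → ℝ) : Prop where
  isClosed_le : ∀ t, IsClosed {c | t ≤ f c}
  exists_pos : ∀ U : Set C, IsClopen U → U.Nonempty → ∃ c ∈ U, 0 < f c
  exists_between : ∀ U : Set C, IsClopen U → ∀ c ∈ U, ∀ s t, 0 < s → s < t → t ≤ f c →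
    ∃ c' ∈ U, s < f c' ∧ f c' < t

/-! ### Suprema of Lelek functions over clopen sets. -/

section SupOn

variable {C : Type*} [TopologicalSpace C] [CompactSpace C] {f : C → ℝ}

/-- The supremum of `f` on `U`. -/
noncomputable def supOn {C : Type*} (f : C → ℝ) (U : Set C) : ℝ := sSup (f '' U)

theorem LelekFunction.exists_supOn (hf : LelekFunction f) {U : Set C} (hU : IsClopen U)
    (hne : U.Nonempty) : ∃ c ∈ U, f c = supOn f U ∧ ∀ c' ∈ U, f c' ≤ supOn f U := by
  have husc : UpperSemicontinuous f :=
    upperSemicontinuous_iff_isClosed_preimage.2 fun t => hf.isClosed_le t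
  obtain ⟨c, hc, hmax⟩ := (husc.upperSemicontinuousOn U).exists_isMaxOn hne hU.isClosed.isCompact
  have hg : IsGreatest (f '' U) (f c) := ⟨⟨c, hc, rfl⟩, by
    rintro _ ⟨c', hc', rfl⟩
    exact hmax hc'⟩
  have he : supOn f U = f c := hg.csSup_eq
  exact ⟨c, hc, he.symm, fun c' hc' => he ▸ hmax hc'⟩

theorem LelekFunction.le_supOn (hf : LelekFunction f) {U : Set C} (hU : IsClopen U) {c : C}
    (hc : c ∈ U) : f c ≤ supOn f U :=
  (hf.exists_supOn hU ⟨c, hc⟩).choose_spec.2.2 c hc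

theorem LelekFunction.supOn_pos (hf : LelekFunction f) {U : Set C} (hU : IsClopen U)
    (hne : U.Nonempty) : 0 < supOn f U := by
  obtain ⟨c, hc, hpos⟩ := hf.exists_pos U hU hne
  exact hpos.trans_le (hf.le_supOn hU hc)

theorem LelekFunction.supOn_mono (hf : LelekFunction f) {U V : Set C} (hU : IsClopen U)
    (hV : IsClopen V) (hne : U.Nonempty) (hUV : U ⊆ V) : supOn f U ≤ supOn f V := by
  obtain ⟨c, hc, he, -⟩ := hf.exists_supOn hU hne
  exact he ▸ hf.le_supOn hV (hUV hc)

/-- A clopen set contains a clopen set with prescribed approximate supremum whose complement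
still has the full supremum. -/
theorem LelekFunction.exists_split [T2Space C] [TotallyDisconnectedSpace C]
    (hf : LelekFunction f) {V : Set C} (hV : IsClopen V) (hne : V.Nonempty) {s ε : ℝ} (hs : 0 < s)
    (hsV : s ≤ supOn f V) (hε : 0 < ε) :
    ∃ W ⊆ V, IsClopen W ∧ W.Nonempty ∧ (V \ W).Nonempty ∧ supOn f (V \ W) = supOn f V ∧
      |Real.log (supOn f W) - Real.log s| ≤ ε := by
  obtain ⟨d₁, hd₁, he, hle⟩ := hf.exists_supOn hV hne
  have hexp : s * Real.exp (-ε) < s :=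
    mul_lt_of_lt_one_right hs (Real.exp_lt_one_iff.2 (by linarith))
  obtain ⟨d, hd, h1, h2⟩ := hf.exists_between V hV d₁ hd₁ (s * Real.exp (-ε)) s (by positivity)
    hexp (he ▸ hsV)
  -- Near `d`, whose value is just below `s`, the function stays below `s` by semicontinuity. The
  -- maximum point `d₁` has value at least `s` and so remains outside `W`.
  obtain ⟨W, hW, hdW, hWV⟩ := compact_exists_isClopen_in_isOpen
    (hV.isOpen.inter (hf.isClosed_le s).isOpen_compl) ⟨hd, not_le.2 h2⟩
  have hd₁W : d₁ ∈ V \ W := ⟨hd₁, fun h => (hWV h).2 (show s ≤ f d₁ from he ▸ hsV)⟩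
  have hVW : IsClopen (V \ W) := hV.diff hW
  refine ⟨W, fun x hx => (hWV hx).1, hW, ⟨d, hdW⟩, ⟨d₁, hd₁W⟩, ?_, ?_⟩
  · exact le_antisymm (hf.supOn_mono hVW hV ⟨d₁, hd₁W⟩ sdiff_subset) (he ▸ hf.le_supOn hVW hd₁W)
  · obtain ⟨e, heW, he', -⟩ := hf.exists_supOn hW ⟨d, hdW⟩
    have hupper : supOn f W ≤ s := he' ▸ (not_le.1 (show ¬ s ≤ f e from (hWV heW).2)).le
    have hlower : s * Real.exp (-ε) ≤ supOn f W := h1.le.trans (hf.le_supOn hW hdW)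
    have hlog1 := Real.log_le_log (hf.supOn_pos hW ⟨d, hdW⟩) hupper
    have hlog2 := Real.log_le_log (by positivity) hlower
    rw [Real.log_mul hs.ne' (Real.exp_pos _).ne', Real.log_exp] at hlog2
    rw [abs_le]
    constructor <;> linarith

end SupOn

/-! ### The back-and-forth argument for Lelek functions. -/

section BackAndForth

theorem _root_.IsLocallyConstant.isClopen_preimage_singleton {C β : Type*} [TopologicalSpace C]
    {u : C → β} (hu : IsLocallyConstant u) (j : β) : IsClopen (u ⁻¹' {j}) :=
  hu.isClopen_fiber j

/-- The logarithm of the quotient of the suprema of `g` and `f` on corresponding pieces. -/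
noncomputable def logRatio {C D : Type*} (f : C → ℝ) (g : D → ℝ) (u : C → List Bool)
    (v : D → List Bool) (j : List Bool) : ℝ :=
  Real.log (supOn g (v ⁻¹' {j})) - Real.log (supOn f (u ⁻¹' {j}))

theorem logRatio_symm {C D : Type*} (f : C → ℝ) (g : D → ℝ) (u : C → List Bool)
    (v : D → List Bool) (j : List Bool) : logRatio g f v u j = -logRatio f g u v j := by
  unfold logRatio
  ring

variable {C D : Type*} [TopologicalSpace C] [TopologicalSpace D]

/-- A pair of matched finite clopen partitions of `C` and `D`, given by codes of the pieces. -/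
structure Matching (u : C → List Bool) (v : D → List Bool) : Prop where
  left : IsLocallyConstant u
  right : IsLocallyConstant v
  range_eq : range u = range v

theorem Matching.symm {u : C → List Bool} {v : D → List Bool} (h : Matching u v) :
    Matching v u :=
  ⟨h.right, h.left, h.range_eq.symm⟩

variable [CompactSpace C] [CompactSpace D] {f : C → ℝ} {g : D → ℝ}

/-- One half of `U` keeps the supremum of `U` and is matched with the part `V \ W` keeping the
supremum of `V`. The supremum of the other half, rescaled by `supOn g V / supOn f U`, is
approximated on `W`. If a half of `U` is empty, a constant `b` works. -/
theorem exists_split_piece [T2Space D] [TotallyDisconnectedSpace D]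
    (hf : LelekFunction f) (hg : LelekFunction g) {U : Set C} {V : Set D} (hU : IsClopen U)
    (hV : IsClopen V) (hUV : U.Nonempty ↔ V.Nonempty) {w : C → Bool} (hw : IsLocallyConstant w)
    {ε : ℝ} (hε : 0 < ε) :
    ∃ b : D → Bool, IsLocallyConstant b ∧
      (∀ k, (U ∩ w ⁻¹' {k}).Nonempty ↔ (V ∩ b ⁻¹' {k}).Nonempty) ∧
      ∀ k, (U ∩ w ⁻¹' {k}).Nonempty →
        |Real.log (supOn g (V ∩ b ⁻¹' {k})) - Real.log (supOn f (U ∩ w ⁻¹' {k})) -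
          (Real.log (supOn g V) - Real.log (supOn f U))| ≤ ε := by
  classical
  by_cases hboth : ∀ k, (U ∩ w ⁻¹' {k}).Nonempty
  · have hUk : ∀ k, IsClopen (U ∩ w ⁻¹' {k}) := fun k => hU.inter (hw.isClopen_preimage_singleton k)
    have hUne : U.Nonempty := (hboth true).mono inter_subset_left
    have hVne := hUV.1 hUne
    have hU0 := hf.supOn_pos hU hUne
    have hV0 := hg.supOn_pos hV hVne
    obtain ⟨c₀, hc₀, he₀, -⟩ := hf.exists_supOn hU hUne
    have hk₀ : supOn f (U ∩ w ⁻¹' {w c₀}) = supOn f U :=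
      le_antisymm (hf.supOn_mono (hUk _) hU (hboth _) inter_subset_left)
        (he₀ ▸ hf.le_supOn (hUk _) ⟨hc₀, rfl⟩)
    have hk₁pos := hf.supOn_pos (hUk (!w c₀)) (hboth _)
    have hk₁le := hf.supOn_mono (hUk (!w c₀)) hU (hboth _) inter_subset_left
    obtain ⟨W, hWV, hW, hWne, hVWne, hsup, hlog⟩ := hg.exists_split hV hVne
      (s := supOn g V / supOn f U * supOn f (U ∩ w ⁻¹' {!w c₀})) (by positivity) (by
        rw [div_mul_eq_mul_div, div_le_iff₀ hU0]
        exact mul_le_mul_of_nonneg_left hk₁le hV0.le) hε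
    let b : D → Bool := fun d => if d ∈ W then !w c₀ else w c₀
    have hb1 : V ∩ b ⁻¹' {!w c₀} = W := by
      ext d
      by_cases hd : d ∈ W
      · simp [b, hd, hWV hd]
      · simp [b, hd]
    have hb0 : V ∩ b ⁻¹' {w c₀} = V \ W := by
      ext d
      by_cases hd : d ∈ W
      · simp [b, hd]
      · simp [b, hd]
    have hcase : ∀ P : Bool → Prop, P (w c₀) → P (!w c₀) → ∀ k, P k := by
      intro P h0 h1 k
      cases hk : w c₀ <;> cases k <;> simp_all
    refine ⟨b, ?_, ?_, ?_⟩
    · rw [IsLocallyConstant.iff_eventually_eq]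
      intro d
      by_cases hd : d ∈ W
      · filter_upwards [hW.isOpen.mem_nhds hd] with d' hd'
        simp [b, hd, hd']
      · filter_upwards [hW.compl.isOpen.mem_nhds hd] with d' hd'
        simp [b, hd, show d' ∉ W from hd']
    · refine hcase _ (iff_of_true (hboth _) (hb0 ▸ hVWne)) (iff_of_true (hboth _) (hb1 ▸ hWne))
    · refine hcase _ (fun _ => ?_) (fun _ => ?_)
      · rw [hb0, hsup, hk₀, sub_self, abs_zero]
        exact hε.le
      · rw [hb1]
        rw [Real.log_mul (by positivity) hk₁pos.ne', Real.log_div hV0.ne' hU0.ne'] at hlog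
        convert hlog using 2
        ring
  · push Not at hboth
    obtain ⟨k₀, hk₀⟩ := hboth
    have hwU : ∀ c ∈ U, w c = !k₀ := by
      intro c hc
      by_contra hne
      have : c ∈ U ∩ w ⁻¹' {k₀} := ⟨hc, by simpa using hne⟩
      rw [hk₀] at this
      exact this
    have hkU : ∀ k, (U ∩ w ⁻¹' {k}).Nonempty → k = !k₀ := by
      rintro k ⟨c, hc, rfl⟩
      exact hwU c hc
    have hkV : ∀ k, (V ∩ (fun _ => !k₀) ⁻¹' {k}).Nonempty → k = !k₀ := by
      rintro k ⟨c, -, hc⟩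
      exact hc.symm
    have h1 : U ∩ w ⁻¹' {!k₀} = U := inter_eq_left.2 hwU
    have h2 : V ∩ (fun _ => !k₀) ⁻¹' {!k₀} = V := inter_eq_left.2 fun _ _ => rfl
    refine ⟨fun _ => !k₀, IsLocallyConstant.const _, fun k => ⟨fun h => ?_, fun h => ?_⟩,
      fun k h => ?_⟩
    · obtain rfl := hkU k h
      rw [h1] at h
      rw [h2]
      exact hUV.1 h
    · obtain rfl := hkV k h
      rw [h2] at h
      rw [h1]
      exact hUV.2 h
    · obtain rfl := hkU k h
      rw [h1, h2, sub_self, abs_zero]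
      exact hε.le

/-- Refining a matching by a two-piece clopen partition of the left space. -/
theorem Matching.exists_refinement [T2Space D] [TotallyDisconnectedSpace D]
    (hf : LelekFunction f) (hg : LelekFunction g) {u : C → List Bool} {v : D → List Bool}
    (h : Matching u v) {w : C → Bool} (hw : IsLocallyConstant w) {ε : ℝ} (hε : 0 < ε) :
    ∃ (u' : C → List Bool) (v' : D → List Bool), Matching u' v' ∧ (∀ c, (u' c).tail = u c) ∧
      (∀ d, (v' d).tail = v d) ∧ (∀ c c', u' c = u' c' → w c = w c') ∧
      ∀ c, |logRatio f g u' v' (u' c) - logRatio f g u v (u c)| ≤ ε := by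
  have hpiece : ∀ i : List Bool, _ := fun i => exists_split_piece hf hg
    (h.left.isClopen_preimage_singleton i) (h.right.isClopen_preimage_singleton i) (by
      constructor
      · rintro ⟨c, hc⟩
        obtain ⟨d, hd⟩ : i ∈ range v := h.range_eq ▸ ⟨c, hc⟩
        exact ⟨d, hd⟩
      · rintro ⟨c, hc⟩
        obtain ⟨d, hd⟩ : i ∈ range u := h.range_eq ▸ ⟨c, hc⟩
        exact ⟨d, hd⟩) hw hε
  choose b hb1 hb2 hb3 using hpiece
  -- New bits are put at the head, so `List.tail` recovers the coarser code.
  let u' : C → List Bool := fun c => w c :: u c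
  let v' : D → List Bool := fun d => b (v d) d :: v d
  have hu' : ∀ k i, u' ⁻¹' {k :: i} = u ⁻¹' {i} ∩ w ⁻¹' {k} := by
    intro k i
    ext c
    simp [u', and_comm]
  have hv' : ∀ k i, v' ⁻¹' {k :: i} = v ⁻¹' {i} ∩ b i ⁻¹' {k} := by
    intro k i
    ext d
    simp only [v', mem_preimage, mem_singleton_iff, List.cons.injEq, mem_inter_iff]
    constructor
    · rintro ⟨h1, rfl⟩
      exact ⟨rfl, h1⟩
    · rintro ⟨rfl, h1⟩
      exact ⟨h1, rfl⟩
  refine ⟨u', v', ⟨?_, ?_, ?_⟩, fun c => rfl, fun d => rfl, fun c c' hcc => (List.cons.inj hcc).1,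
    ?_⟩
  · rw [IsLocallyConstant.iff_eventually_eq] at hw ⊢
    intro c
    filter_upwards [hw c, h.left.eventually_eq c] with c' h1 h2
    simp [u', h1, h2]
  · rw [IsLocallyConstant.iff_eventually_eq]
    intro d
    filter_upwards [(hb1 (v d)).eventually_eq d, h.right.eventually_eq d] with d' h1 h2
    simp [v', h1, h2]
  · have hiff : ∀ k i, (u' ⁻¹' {k :: i}).Nonempty ↔ (v' ⁻¹' {k :: i}).Nonempty := by
      intro k i
      rw [hu', hv']
      exact hb2 i k
    ext j
    constructor
    · rintro ⟨c, rfl⟩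
      obtain ⟨d, hd⟩ := (hiff (w c) (u c)).1 ⟨c, rfl⟩
      exact ⟨d, hd⟩
    · rintro ⟨d, rfl⟩
      obtain ⟨c, hc⟩ := (hiff (b (v d) d) (v d)).2 ⟨d, rfl⟩
      exact ⟨c, hc⟩
  · intro c
    have := hb3 (u c) (w c) ⟨c, rfl, rfl⟩
    rw [← hu', ← hv'] at this
    exact this

/-- Forth, then back: first split the left space and copy the splitting to the right, then exchange
the roles. Each half costs `ε / 2`, and two bits are added. -/
theorem Matching.exists_refinement_both [T2Space C] [TotallyDisconnectedSpace C] [T2Space D]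
    [TotallyDisconnectedSpace D] (hf : LelekFunction f) (hg : LelekFunction g)
    {u : C → List Bool} {v : D → List Bool} (h : Matching u v) {w : C → Bool}
    (hw : IsLocallyConstant w) {z : D → Bool} (hz : IsLocallyConstant z) {ε : ℝ} (hε : 0 < ε) :
    ∃ p : (C → List Bool) × (D → List Bool), Matching p.1 p.2 ∧
      (∀ c, (p.1 c).tail.tail = u c) ∧ (∀ d, (p.2 d).tail.tail = v d) ∧
      (∀ c c', p.1 c = p.1 c' → w c = w c') ∧ (∀ d d', p.2 d = p.2 d' → z d = z d') ∧
      ∀ c, |logRatio f g p.1 p.2 (p.1 c) - logRatio f g u v (u c)| ≤ ε := by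
  obtain ⟨u₁, v₁, h₁, h2, h3, h4, h5⟩ := h.exists_refinement hf hg hw (half_pos hε)
  obtain ⟨v₂, u₂, h₂, k2, k3, k4, k5⟩ := h₁.symm.exists_refinement hg hf hz (half_pos hε)
  refine ⟨(u₂, v₂), h₂.symm, fun c => by simp only [k3, h2], fun d => by simp only [k2, h3],
    fun c c' hcc => ?_, k4, fun c => ?_⟩
  · refine h4 c c' ?_
    rw [← k3, ← k3]
    exact congrArg List.tail hcc
  · obtain ⟨d, hd⟩ : u₂ c ∈ range v₂ := h₂.range_eq ▸ mem_range_self c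
    have hd1 : v₁ d = u₁ c := by rw [← k2, ← k3, hd]
    have h6 := k5 d
    rw [logRatio_symm f g, logRatio_symm f g, hd, hd1, abs_sub_comm] at h6
    have h7 := h5 c
    simp only
    rw [abs_le] at h6 h7 ⊢
    constructor <;> linarith [h6.1, h6.2, h7.1, h7.2]

/-- The pieces around `c` shrink to `c`. For `a > f c`, their parts where `f` is at least `a` are
nested compact sets with empty intersection, so one of them is already empty. -/
theorem tendsto_supOn (hf : LelekFunction f) {u : ℕ → C → List Bool}
    (hu : ∀ n, IsLocallyConstant (u n)) (hmono : ∀ n c c', u (n + 1) c = u (n + 1) c' →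
      u n c = u n c') (hsep : ∀ c c', (∀ n, u n c = u n c') → c = c') (c : C) :
    Tendsto (fun n => supOn f (u n ⁻¹' {u n c})) atTop (𝓝 (f c)) := by
  have hle : ∀ n, f c ≤ supOn f (u n ⁻¹' {u n c}) := fun n =>
    hf.le_supOn ((hu n).isClopen_preimage_singleton _) rfl
  rw [tendsto_order]
  refine ⟨fun a ha => Eventually.of_forall fun n => ha.trans_le (hle n), fun a ha => ?_⟩
  let K : ℕ → Set C := fun n => u n ⁻¹' {u n c} ∩ {c' | a ≤ f c'}
  have hKanti : ∀ n, K (n + 1) ⊆ K n := fun n c' hc' => ⟨hmono n _ _ hc'.1, hc'.2⟩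
  have hKclosed : ∀ n, IsClosed (K n) := fun n =>
    ((hu n).isClopen_preimage_singleton _).isClosed.inter (hf.isClosed_le a)
  obtain ⟨N, hN⟩ : ∃ N, ¬ (K N).Nonempty := by
    by_contra! hne
    obtain ⟨c', hc'⟩ := IsCompact.nonempty_iInter_of_sequence_nonempty_isCompact_isClosed K hKanti
      hne (hKclosed 0).isCompact hKclosed
    rw [mem_iInter] at hc'
    have : c' = c := hsep _ _ fun n => (hc' n).1
    exact absurd (hc' 0).2 (not_le.2 (this ▸ ha))
  have hKm : Antitone K := antitone_nat_of_succ_le hKanti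
  filter_upwards [eventually_ge_atTop N] with n hn
  obtain ⟨c', hc', he, -⟩ := hf.exists_supOn ((hu n).isClopen_preimage_singleton (u n c)) ⟨c, rfl⟩
  rw [← he]
  by_contra! hlt
  exact hN ⟨c', hKm hn ⟨hc', hlt⟩⟩

/-- **Uniqueness of Lelek functions.** -/
theorem LelekFunction.exists_homeomorph [T2Space C] [TotallyDisconnectedSpace C] [T2Space D]
    [TotallyDisconnectedSpace D] [Nonempty C] [Nonempty D] (hf : LelekFunction f)
    (hg : LelekFunction g) {w : C → ℕ → Bool} (hw : Continuous w) (hwi : Function.Injective w)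
    {z : D → ℕ → Bool} (hz : Continuous z) (hzi : Function.Injective z) :
    ∃ (h : C ≃ₜ D) (α : C → ℝ), Continuous α ∧ (∀ c, 0 < α c) ∧ ∀ c, g (h c) = α c * f c := by
  have hwl : ∀ n, IsLocallyConstant fun c => w c n := fun n =>
    (IsLocallyConstant.iff_continuous _).2 (by fun_prop)
  have hzl : ∀ n, IsLocallyConstant fun d => z d n := fun n =>
    (IsLocallyConstant.iff_continuous _).2 (by fun_prop)
  -- Step `n` splits by the `n`-th coordinates of `w` and `z`, so in the limit the pieces separate
  -- points. The errors `(1 / 2) ^ n` are summable.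
  have hstep : ∀ (n : ℕ) (p : (C → List Bool) × (D → List Bool)), Matching p.1 p.2 →
      ∃ q : (C → List Bool) × (D → List Bool), Matching q.1 q.2 ∧
      (∀ c, (q.1 c).tail.tail = p.1 c) ∧ (∀ d, (q.2 d).tail.tail = p.2 d) ∧
      (∀ c c', q.1 c = q.1 c' → w c n = w c' n) ∧ (∀ d d', q.2 d = q.2 d' → z d n = z d' n) ∧
      ∀ c, |logRatio f g q.1 q.2 (q.1 c) - logRatio f g p.1 p.2 (p.1 c)| ≤ (1 / 2) ^ n :=
    fun n p hp => hp.exists_refinement_both hf hg (hwl n) (hzl n) (by positivity)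
  choose! nxt hn1 hn2 hn3 hn4 hn5 hn6 using hstep
  let p : ℕ → (C → List Bool) × (D → List Bool) := fun n =>
    Nat.rec (fun _ => [], fun _ => []) nxt n
  have hp : ∀ n, Matching (p n).1 (p n).2 := fun n => by
    induction n with
    | zero => exact ⟨IsLocallyConstant.const _, IsLocallyConstant.const _, by simp [p]⟩
    | succ n ih => exact hn1 n _ ih
  let u : ℕ → C → List Bool := fun n => (p n).1
  let v : ℕ → D → List Bool := fun n => (p n).2
  have hu : ∀ n c, (u (n + 1) c).tail.tail = u n c := fun n => hn2 n _ (hp n)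
  have hv : ∀ n d, (v (n + 1) d).tail.tail = v n d := fun n => hn3 n _ (hp n)
  have humono : ∀ n c c', u (n + 1) c = u (n + 1) c' → u n c = u n c' := fun n c c' he => by
    rw [← hu, ← hu, he]
  have hvmono : ∀ n c c', v (n + 1) c = v (n + 1) c' → v n c = v n c' := fun n c c' he => by
    rw [← hv, ← hv, he]
  have husep : ∀ c c', (∀ n, u n c = u n c') → c = c' := fun c c' he =>
    hwi (funext fun n => hn4 n _ (hp n) c c' (he (n + 1)))
  have hvsep : ∀ c c', (∀ n, v n c = v n c') → c = c' := fun c c' he =>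
    hzi (funext fun n => hn5 n _ (hp n) c c' (he (n + 1)))
  have hfu : ∀ n j, IsClosed (u n ⁻¹' {j}) :=
    fun n j => ((hp n).left.isClopen_preimage_singleton j).isClosed
  have hfv : ∀ n j, IsClosed (v n ⁻¹' {j}) :=
    fun n j => ((hp n).right.isClopen_preimage_singleton j).isClosed
  have hcd : ∀ c, ∃ d, ∀ n, v n d = u n c := by
    intro c
    obtain ⟨d, hd⟩ := IsCompact.nonempty_iInter_of_sequence_nonempty_isCompact_isClosed
      (fun n => v n ⁻¹' {u n c}) (fun n d (hd : v (n + 1) d = u (n + 1) c) =>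
        show v n d = u n c by rw [← hv, ← hu, hd])
      (fun n => by
        obtain ⟨d, hd⟩ : u n c ∈ range (v n) := (hp n).range_eq ▸ mem_range_self c
        exact ⟨d, hd⟩)
      (hfv 0 _).isCompact (fun n => hfv n _)
    exact ⟨d, fun n => mem_iInter.1 hd n⟩
  have hdc : ∀ d, ∃ c, ∀ n, u n c = v n d := by
    intro d
    obtain ⟨c, hc⟩ := IsCompact.nonempty_iInter_of_sequence_nonempty_isCompact_isClosed
      (fun n => u n ⁻¹' {v n d}) (fun n c (hc : u (n + 1) c = v (n + 1) d) =>
        show u n c = v n d by rw [← hv, ← hu, hc])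
      (fun n => by
        obtain ⟨c, hc⟩ : v n d ∈ range (u n) := (hp n).range_eq ▸ mem_range_self d
        exact ⟨c, hc⟩)
      (hfu 0 _).isCompact (fun n => hfu n _)
    exact ⟨c, fun n => mem_iInter.1 hc n⟩
  choose φ hφ using hcd
  choose ψ hψ using hdc
  let e : C ≃ D :=
    { toFun := φ
      invFun := ψ
      left_inv := fun c => husep _ _ fun n => by rw [hψ, hφ]
      right_inv := fun d => hvsep _ _ fun n => by rw [hφ, hψ] }
  have hφc : Continuous φ := by
    apply continuous_of_isClosed_graph
    have : {q : C × D | q.2 = φ q.1} = ⋂ n, {q : C × D | (v n q.2 = u n q.1)} := by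
      ext ⟨c, d⟩
      simp only [mem_ofPred_eq, mem_iInter]
      constructor
      · rintro rfl n
        exact hφ c n
      · intro hq
        exact hvsep _ _ fun n => by rw [hq n, hφ]
    rw [this]
    refine isClosed_iInter fun n => ?_
    have hl : IsLocallyConstant fun q : C × D => (v n q.2 = u n q.1) := by
      rw [IsLocallyConstant.iff_eventually_eq]
      intro q
      filter_upwards [continuous_fst.continuousAt.eventually ((hp n).left.eventually_eq q.1),
        continuous_snd.continuousAt.eventually ((hp n).right.eventually_eq q.2)] with q' h1 h2
      change ((p n).2 q'.2 = (p n).1 q'.1) = ((p n).2 q.2 = (p n).1 q.1)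
      rw [h1, h2]
    convert (hl.isClopen_preimage_singleton True).isClosed using 1
    ext q
    simp
  let a : ℕ → C → ℝ := fun n c => logRatio f g (u n) (v n) (u n c)
  have hac : ∀ n, Continuous (a n) := fun n =>
    ((hp n).left.comp (logRatio f g (u n) (v n))).continuous
  have hastep : ∀ n c, ‖a (n + 1) c - a n c‖ ≤ (1 / 2) ^ n := fun n c => hn6 n _ (hp n) c
  -- The telescoping series converges uniformly, so the limit of the locally constant log ratios is
  -- continuous. The factor `α` is its exponential.
  let A : C → ℝ := fun c => a 0 c + ∑' n, (a (n + 1) c - a n c)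
  have hA : Continuous A := (hac 0).add
    (continuous_tsum (fun n => (hac (n + 1)).sub (hac n)) summable_geometric_two hastep)
  have hlim : ∀ c, Tendsto (fun n => a n c) atTop (𝓝 (A c)) := by
    intro c
    have hs : Summable fun n => a (n + 1) c - a n c :=
      Summable.of_norm_bounded summable_geometric_two fun n => hastep n c
    have := hs.hasSum.tendsto_sum_nat.const_add (a 0 c)
    refine this.congr fun n => ?_
    rw [Finset.sum_range_sub (fun n => a n c)]
    ring
  refine ⟨hφc.homeoOfEquivCompactToT2 (f := e), fun c => Real.exp (A c), hA.rexp,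
    fun c => Real.exp_pos _, fun c => ?_⟩
  change g (φ c) = _
  have h1 := tendsto_supOn hf (fun n => (hp n).left) humono husep c
  have h2 := tendsto_supOn hg (fun n => (hp n).right) hvmono hvsep (φ c)
  have h3 := ((Real.continuous_exp.tendsto _).comp (hlim c)).mul h1
  refine tendsto_nhds_unique (h2.congr fun n => ?_) h3
  have hne1 : (u n ⁻¹' {u n c}).Nonempty := ⟨c, rfl⟩
  have hne2 : (v n ⁻¹' {u n c}).Nonempty := ⟨φ c, hφ c n⟩
  have hpos1 := hf.supOn_pos ((hp n).left.isClopen_preimage_singleton (u n c)) hne1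
  have hpos2 := hg.supOn_pos ((hp n).right.isClopen_preimage_singleton (u n c)) hne2
  change supOn g (v n ⁻¹' {v n (φ c)}) = Real.exp (a n c) * supOn f (u n ⁻¹' {u n c})
  simp only [a, logRatio]
  rw [hφ, Real.exp_sub, Real.exp_log hpos2, Real.exp_log hpos1, div_mul_cancel₀ _ hpos1.ne']

end BackAndForth

/-! ### Leg heights, and uniqueness of the Lelek fan. -/

namespace FanChart

section LegHeight

variable {X : Type*} [TopologicalSpace X] {v : X} {μ : X → ℝ} {π : X → ℕ → Bool}

/-- The supremum of the heights of the points on the leg with code `c`. -/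
noncomputable def legHeight {X : Type*} (μ : X → ℝ) (π : X → ℕ → Bool) (c : ℕ → Bool) : ℝ :=
  sSup (insert 0 (μ '' (π ⁻¹' {c})))

/-- The closed set of codes in which the codes of legs are dense. -/
def legSpace {X : Type*} (v : X) (π : X → ℕ → Bool) : Set (ℕ → Bool) :=
  closure (π '' {v}ᶜ)

theorem bddAbove_heights [CompactSpace X] (h : FanChart v μ π) (c : ℕ → Bool) :
    BddAbove (insert 0 (μ '' (π ⁻¹' {c}))) :=
  bddAbove_insert.2 ((isCompact_range h.continuous_height).bddAbove.mono (image_subset_range _ _))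

theorem legHeight_nonneg [CompactSpace X] (h : FanChart v μ π) (c : ℕ → Bool) :
    0 ≤ legHeight μ π c :=
  le_csSup (h.bddAbove_heights c) (mem_insert _ _)

theorem height_le_legHeight [CompactSpace X] (h : FanChart v μ π) (x : X) :
    μ x ≤ legHeight μ π (π x) :=
  le_csSup (h.bddAbove_heights _) (Or.inr ⟨x, rfl, rfl⟩)

/-- The part of a leg above a positive height is compact, so the supremum is attained. The whole leg
need not be closed, as `π` is only continuous off the top. -/
theorem exists_height_eq_legHeight [CompactSpace X] [T2Space X] (h : FanChart v μ π)
    {c : ℕ → Bool} (hc : 0 < legHeight μ π c) : ∃ y, π y = c ∧ μ y = legHeight μ π c := by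
  obtain ⟨_, rfl | ⟨y₀, hy₀, rfl⟩, hlt⟩ := exists_lt_of_lt_csSup (insert_nonempty _ _)
    (half_lt_self hc : legHeight μ π c / 2 < sSup _)
  · linarith
  have hpos : 0 < μ y₀ := (half_pos hc).trans hlt
  have hK : IsClosed ({y | μ y₀ ≤ μ y} ∩ π ⁻¹' {c}) :=
    (h.continuousOn_leg.mono fun y (hy : μ y₀ ≤ μ y) =>
      h.ne_top (hpos.trans_le hy)).preimage_isClosed_of_isClosed
      (isClosed_le continuous_const h.continuous_height) isClosed_singleton
  obtain ⟨y, hy, hmax⟩ := hK.isCompact.exists_isMaxOn ⟨y₀, show μ y₀ ≤ μ y₀ from le_rfl, hy₀⟩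
    h.continuous_height.continuousOn
  refine ⟨y, hy.2, le_antisymm ?_ ?_⟩
  · have := h.height_le_legHeight y
    rwa [show π y = c from hy.2] at this
  · refine csSup_le (insert_nonempty _ _) ?_
    rintro _ (rfl | ⟨z, hz, rfl⟩)
    · exact h.height_nonneg y
    · rcases le_total (μ z) (μ y₀) with hle | hle
      · exact hle.trans hy.1
      · exact hmax ⟨hle, hz⟩

theorem exists_of_le_legHeight [CompactSpace X] [T2Space X] (h : FanChart v μ π)
    {c : ℕ → Bool} {t : ℝ} (ht : 0 < t) (htc : t ≤ legHeight μ π c) :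
    ∃ y, π y = c ∧ μ y = t := by
  obtain ⟨y, rfl, hy⟩ := h.exists_height_eq_legHeight (ht.trans_le htc)
  exact h.exists_below y t ht (hy ▸ htc)

/-- For `t > 0` the superlevel set is the set of codes of the compact level `μ = t`, because legs
are full below their points. An end-point is the highest point of its leg, so an end-point at height
between `s` and `t` with code in `U` provides the intermediate value. Codes in the closure that
carry no leg get height `0` from the inserted `0`. -/
theorem lelekFunction [CompactSpace X] [T2Space X] (h : FanChart v μ π)
    (hd : Dense (endPoints X)) :
    LelekFunction fun c : legSpace v π => legHeight μ π c := by
  refine ⟨fun t => ?_, ?_, ?_⟩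
  · rcases le_or_gt t 0 with ht | ht
    · convert isClosed_univ
      exact eq_univ_of_forall fun c => ht.trans (h.legHeight_nonneg _)
    · have hcl : IsClosed (π '' {y | μ y = t}) := by
        refine IsCompact.isClosed (IsCompact.image_of_continuousOn
          (isClosed_eq h.continuous_height continuous_const).isCompact
          (h.continuousOn_leg.mono ?_))
        rintro y (rfl : μ y = t)
        exact h.ne_top ht
      convert hcl.preimage (continuous_subtype_val (p := fun c => c ∈ legSpace v π)) using 1
      ext c
      constructor
      · intro hc
        obtain ⟨y, h1, h2⟩ := h.exists_of_le_legHeight ht hc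
        exact ⟨y, h2, h1⟩
      · rintro ⟨y, rfl, hy⟩
        have := h.height_le_legHeight y
        rwa [hy] at this
  · rintro U hU ⟨c, hc⟩
    obtain ⟨O, hO, rfl⟩ := isOpen_induced_iff.1 hU.isOpen
    obtain ⟨_, hy, y, hyv, rfl⟩ := mem_closure_iff.1 c.2 O hO hc
    exact ⟨⟨π y, subset_closure ⟨y, hyv, rfl⟩⟩, hy, (h.pos hyv).trans_le (h.height_le_legHeight y)⟩
  · rintro U hU c hc s t hs hst htc
    obtain ⟨O, hO, rfl⟩ := isOpen_induced_iff.1 hU.isOpen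
    obtain ⟨m, hsm, hmt⟩ := exists_between hst
    obtain ⟨y, hy, hym⟩ := h.exists_of_le_legHeight (hs.trans hsm) (hmt.le.trans htc)
    have hN : IsOpen (({v}ᶜ ∩ π ⁻¹' O) ∩ μ ⁻¹' Ioo s t) :=
      (h.continuousOn_leg.isOpen_inter_preimage isOpen_compl_singleton hO).inter
        (isOpen_Ioo.preimage h.continuous_height)
    obtain ⟨e, ⟨⟨hev, heO⟩, hes, het⟩, hee⟩ := hd.inter_open_nonempty _ hN
      ⟨y, ⟨h.ne_top (by rw [hym]; exact hs.trans hsm), show π y ∈ O from hy ▸ hc⟩,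
        by rw [mem_preimage, hym]; exact ⟨hsm, hmt⟩⟩
    have he : legHeight μ π (π e) = μ e := by
      refine le_antisymm (csSup_le (insert_nonempty _ _) ?_) (h.height_le_legHeight e)
      rintro _ (rfl | ⟨z, hz, rfl⟩)
      · exact h.height_nonneg e
      · exact h.height_le_of_mem_endPoints hev hee hz
    exact ⟨⟨π e, subset_closure ⟨e, hev, rfl⟩⟩, heO, by simpa only [he] using hes,
      by simpa only [he] using het⟩

end LegHeight

/-- Two fans with fan charts and dense sets of end-points are homeomorphic. -/
theorem nonempty_homeomorph {X Y : Type*} [TopologicalSpace X] [TopologicalSpace Y]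
    [CompactSpace X] [T2Space X] [CompactSpace Y] [T2Space Y]
    {v : X} {μ : X → ℝ} {π : X → ℕ → Bool} (h : FanChart v μ π) (hd : Dense (endPoints X))
    (hne : ∃ x, x ≠ v) {v' : Y} {μ' : Y → ℝ} {π' : Y → ℕ → Bool} (h' : FanChart v' μ' π')
    (hd' : Dense (endPoints Y)) (hne' : ∃ y, y ≠ v') : Nonempty (X ≃ₜ Y) := by
  classical
  have : CompactSpace (legSpace v π) := isCompact_iff_compactSpace.1 isClosed_closure.isCompact
  have : CompactSpace (legSpace v' π') := isCompact_iff_compactSpace.1 isClosed_closure.isCompact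
  obtain ⟨x₀, hx₀⟩ := hne
  obtain ⟨y₀, hy₀⟩ := hne'
  have hleg : ∀ x, x ≠ v → π x ∈ legSpace v π := fun x hx => subset_closure ⟨x, hx, rfl⟩
  have hleg' : ∀ y, y ≠ v' → π' y ∈ legSpace v' π' := fun y hy => subset_closure ⟨y, hy, rfl⟩
  have : Nonempty (legSpace v π) := ⟨⟨_, hleg x₀ hx₀⟩⟩
  have : Nonempty (legSpace v' π') := ⟨⟨_, hleg' y₀ hy₀⟩⟩
  obtain ⟨φ, α, hα, hαpos, hφ⟩ := (h.lelekFunction hd).exists_homeomorph (h'.lelekFunction hd')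
    (w := Subtype.val) continuous_subtype_val Subtype.val_injective
    (z := Subtype.val) continuous_subtype_val Subtype.val_injective
  -- The value at `v` is an arbitrary default; there it is always multiplied by the height `0`.
  let κ : X → legSpace v π := fun x => if hx : x ≠ v then ⟨π x, hleg x hx⟩ else ⟨_, hleg x₀ hx₀⟩
  have hκ : ∀ x, x ≠ v → (κ x : ℕ → Bool) = π x := fun x hx => by simp only [κ, dif_pos hx]
  have hκc : ∀ x, x ≠ v → ContinuousAt κ x := by
    intro x hx
    rw [ContinuousAt, IsInducing.subtypeVal.tendsto_nhds_iff]
    simp only [hκ x hx]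
    refine (h.continuousAt_leg hx).tendsto.congr' ?_
    filter_upwards [isOpen_compl_singleton.mem_nhds hx] with z hz
    exact (hκ z hz).symm
  -- The map sends the leg `κ x` to the leg `φ (κ x)` and multiplies heights by `α (κ x)`. The
  -- relation between the leg heights says exactly that the image leg is long enough.
  have hex : ∀ x, ∃ y, μ' y = α (κ x) * μ x ∧ (x ≠ v → π' y = φ (κ x)) := by
    intro x
    by_cases hx : x = v
    · exact ⟨v', by rw [h'.height_top, hx, h.height_top, mul_zero], fun hx' => absurd hx hx'⟩
    · obtain ⟨y, h1, h2⟩ := h'.exists_of_le_legHeight (c := φ (κ x)) (t := α (κ x) * μ x)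
        (mul_pos (hαpos _) (h.pos hx)) (by
          rw [hφ (κ x), hκ x hx]
          exact mul_le_mul_of_nonneg_left (h.height_le_legHeight x) (hαpos _).le)
      exact ⟨y, h2, fun _ => h1⟩
  choose F hF1 hF2 using hex
  have hFne : ∀ x, F x ≠ v' ↔ x ≠ v := by
    intro x
    constructor
    · rintro hx rfl
      exact hx (h'.eq_top _ (by rw [hF1, h.height_top, mul_zero]))
    · intro hx
      exact h'.ne_top (by rw [hF1]; exact mul_pos (hαpos _) (h.pos hx))
  have hFtop : F v = v' := by
    by_contra hne
    exact (hFne v).1 hne rfl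
  have hinj : Function.Injective F := by
    intro x x' hxx
    by_cases hx : x = v
    · by_contra hne
      exact (hFne x').2 (fun hx' => hne (hx.trans hx'.symm)) (hxx ▸ hx ▸ hFtop)
    · have hx' : x' ≠ v := (hFne x').1 (hxx ▸ (hFne x).2 hx)
      have h1 : (φ (κ x) : ℕ → Bool) = φ (κ x') := by rw [← hF2 x hx, ← hF2 x' hx', hxx]
      have h2 : κ x = κ x' := φ.injective (Subtype.ext h1)
      have h3 := hF1 x
      rw [hxx, hF1, h2] at h3
      refine h.eq_of x x' hx hx' ?_ (mul_left_cancel₀ (hαpos _).ne' h3).symm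
      rw [← hκ x hx, ← hκ x' hx', h2]
  have hsurj : Function.Surjective F := by
    intro y
    by_cases hy : y = v'
    · exact ⟨v, hFtop.trans hy.symm⟩
    · obtain ⟨c, hc⟩ := φ.surjective ⟨π' y, hleg' y hy⟩
      have hle := h'.height_le_legHeight y
      have hc' : π' y = φ c := by rw [hc]
      rw [hc', hφ c] at hle
      obtain ⟨x, h1, h2⟩ := h.exists_of_le_legHeight (c := c) (t := μ' y / α c)
        (div_pos (h'.pos hy) (hαpos c)) ((div_le_iff₀' (hαpos c)).2 hle)
      have hx : x ≠ v := h.ne_top (by rw [h2]; exact div_pos (h'.pos hy) (hαpos c))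
      have hκx : κ x = c := Subtype.ext ((hκ x hx).trans h1)
      refine ⟨x, h'.eq_of _ _ ((hFne x).2 hx) hy ?_ ?_⟩
      · rw [hF2 x hx, hκx, hc']
      · rw [hF1, hκx, h2, mul_div_cancel₀ _ (hαpos c).ne']
  obtain ⟨M, hM⟩ : ∃ M, ∀ c, α c ≤ M := by
    obtain ⟨M, hM⟩ := (isCompact_range hα).bddAbove
    exact ⟨M, fun c => hM (mem_range_self c)⟩
  have hcont : Continuous F := by
    rw [continuous_iff_continuousAt]
    intro x
    refine h'.tendsto ?_ fun hFx => ?_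
    · simp only [hF1]
      -- At the top `κ` may be discontinuous, but `α` is bounded and the height tends to `0`.
      by_cases hx : x = v
      · have hμ : Tendsto (fun z => M * μ z) (𝓝 x) (𝓝 0) := by
          have := (h.continuous_height.tendsto x).const_mul M
          rwa [hx, h.height_top, mul_zero, ← hx] at this
        rw [show α (κ x) * μ x = 0 by rw [hx, h.height_top, mul_zero]]
        exact squeeze_zero (fun z => mul_nonneg (hαpos _).le (h.height_nonneg z))
          (fun z => mul_le_mul_of_nonneg_right (hM _) (h.height_nonneg z)) hμ
      · exact (hα.continuousAt.comp (hκc x hx)).tendsto.mul (h.continuous_height.tendsto x)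
    · have hx := (hFne x).1 hFx
      rw [hF2 x hx]
      have h1 : Tendsto (fun z => (φ (κ z) : ℕ → Bool)) (𝓝 x) (𝓝 (φ (κ x))) :=
        ((continuous_subtype_val.comp φ.continuous).continuousAt.comp (hκc x hx)).tendsto
      refine h1.congr' ?_
      filter_upwards [isOpen_compl_singleton.mem_nhds hx] with z hz
      exact (hF2 z hz).symm
  exact ⟨hcont.homeoOfEquivCompactToT2 (f := Equiv.ofBijective F ⟨hinj, hsurj⟩)⟩

end FanChart

theorem exists_ne_of_mem_ramificationPoints {X : Type*} [TopologicalSpace X] {v : X}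
    (hv : v ∈ ramificationPoints X) : ∃ x, x ≠ v := by
  obtain ⟨T, hT⟩ := hv
  obtain ⟨J, hJ, -⟩ := hT.exists_legs
  obtain ⟨a, -, ha⟩ := (hJ 0).2.2.2
  exact ⟨a, ha⟩

/-- **Uniqueness of the Lelek fan.** -/
theorem IsLelekFan.nonempty_homeomorph {X Y : Type*} [TopologicalSpace X] [TopologicalSpace Y]
    (hX : IsLelekFan X) (hY : IsLelekFan Y) : Nonempty (X ≃ₜ Y) := by
  have := hX.1.1.1.1.2.1
  have := hX.1.1.1.1.2.2
  have := hY.1.1.1.1.2.1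
  have := hY.1.1.1.1.2.2
  obtain ⟨v, hv, μ, π, h⟩ := hX.1.exists_chart
  obtain ⟨v', hv', μ', π', h'⟩ := hY.1.exists_chart
  exact h.nonempty_homeomorph hX.2 (exists_ne_of_mem_ramificationPoints hv) h' hY.2
    (exists_ne_of_mem_ramificationPoints hv')

/-! ### Density of the products of powers of `r` and `ρ`. -/

section Density

/-- A rational quotient with denominator `q.den` would give `r ^ q.den = ρ ^ q.num` with nonzero
exponent on the left. -/
theorem NeverConnect.irrational {r ρ : ℝ} (hr : 0 < r) (h : NeverConnect r ρ) :
    Irrational (Real.log r / Real.log ρ) := by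
  obtain ⟨-, hρ, hkl⟩ := h
  rintro ⟨q, hq⟩
  have hρ0 : 0 < ρ := one_pos.trans hρ
  have hlog : 0 < Real.log ρ := Real.log_pos hρ
  have hden : (q.den : ℝ) ≠ 0 := by exact_mod_cast q.den_ne_zero
  have h1 : (q.den : ℝ) * Real.log r = q.num * Real.log ρ := by
    rw [eq_div_iff hlog.ne'] at hq
    rw [← hq, Rat.cast_def]
    field_simp
  have h2 : r ^ (q.den : ℤ) = ρ ^ q.num := by
    apply Real.log_injOn_pos (show (0 : ℝ) < _ by positivity) (show (0 : ℝ) < _ by positivity)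
    rw [Real.log_zpow, Real.log_zpow]
    exact_mod_cast h1
  have := ((hkl _ _).1 h2).1
  exact q.den_ne_zero (by exact_mod_cast this)

/-- The non-negative integer combinations of a negative and a positive number with irrational
quotient are dense. -/
theorem exists_nat_combination {A B : ℝ} (hA : A < 0) (hB : 0 < B) (hirr : Irrational (A / B))
    {p q : ℝ} (hpq : p < q) : ∃ a b : ℕ, p < a * A + b * B ∧ a * A + b * B < q := by
  have hε : 0 < min (q - p) B := lt_min (sub_pos.2 hpq) hB
  -- Take an integer combination `z = m * A + n * B` with `0 < z < min (q - p) B`. Being positive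
  -- and below `B`, it cannot have coefficients of opposite signs. If both are nonpositive, start at
  -- some `K * B > q` and go down in steps of `z`; otherwise start at some `K * A < p` and go up.
  -- Steps shorter than `q - p` cannot jump over the interval.
  obtain ⟨z, ⟨hz0, hzε⟩, hz⟩ := (dense_addSubgroupClosure_pair_iff.2 hirr).inter_open_nonempty
    (Ioo 0 (min (q - p) B)) isOpen_Ioo (nonempty_Ioo.2 hε)
  obtain ⟨m, n, hmn⟩ := AddSubgroup.mem_closure_pair.1 hz
  simp only [zsmul_eq_mul] at hmn
  obtain ⟨hz1, hz2⟩ := lt_min_iff.1 hzε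
  rcases le_or_gt m 0 with hm | hm
  · have hn : n ≤ 0 := by
      by_contra! hn
      have h1 : (1 : ℝ) ≤ n := by exact_mod_cast hn
      have h2 : (m : ℝ) ≤ 0 := by exact_mod_cast hm
      nlinarith
    obtain ⟨a₀, ha₀⟩ := Int.eq_ofNat_of_zero_le (neg_nonneg.2 hm)
    obtain ⟨b₀, hb₀⟩ := Int.eq_ofNat_of_zero_le (neg_nonneg.2 hn)
    have ha : (m : ℝ) = -a₀ := by
      have : m = -a₀ := by omega
      exact_mod_cast this
    have hb : (n : ℝ) = -b₀ := by
      have : n = -b₀ := by omega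
      exact_mod_cast this
    obtain ⟨K, hK⟩ := exists_nat_gt (q / B)
    rw [div_lt_iff₀ hB] at hK
    have hnn : 0 ≤ (K * B - q) / z := div_nonneg (by linarith) hz0.le
    have hj1 := Nat.lt_floor_add_one ((K * B - q) / z)
    have hj2 := Nat.floor_le hnn
    rw [div_lt_iff₀ hz0] at hj1
    rw [le_div_iff₀ hz0] at hj2
    set j := ⌊(K * B - q) / z⌋₊
    refine ⟨(j + 1) * a₀, K + (j + 1) * b₀, ?_, ?_⟩
    all_goals
      have he : (((j + 1) * a₀ : ℕ) : ℝ) * A + ((K + (j + 1) * b₀ : ℕ) : ℝ) * B =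
          K * B - (j + 1) * z := by
        push_cast
        rw [← hmn, ha, hb]
        ring
      rw [he]
      linarith
  · have hn : 0 ≤ n := by
      by_contra! hn
      have h1 : (1 : ℝ) ≤ m := by exact_mod_cast hm
      have h2 : (n : ℝ) ≤ 0 := by exact_mod_cast hn.le
      nlinarith
    obtain ⟨a₀, rfl⟩ := Int.eq_ofNat_of_zero_le hm.le
    obtain ⟨b₀, rfl⟩ := Int.eq_ofNat_of_zero_le hn
    obtain ⟨K, hK⟩ := exists_nat_gt (p / A)
    rw [div_lt_iff_of_neg hA] at hK
    have hnn : 0 ≤ (p - K * A) / z := div_nonneg (by linarith) hz0.le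
    have hj1 := Nat.lt_floor_add_one ((p - K * A) / z)
    have hj2 := Nat.floor_le hnn
    rw [div_lt_iff₀ hz0] at hj1
    rw [le_div_iff₀ hz0] at hj2
    set j := ⌊(p - K * A) / z⌋₊
    refine ⟨K + (j + 1) * a₀, (j + 1) * b₀, ?_, ?_⟩
    all_goals
      have he : ((K + (j + 1) * a₀ : ℕ) : ℝ) * A + (((j + 1) * b₀ : ℕ) : ℝ) * B =
          K * A + (j + 1) * z := by
        rw [← hmn]
        push_cast
        ring
      rw [he]
      linarith

theorem NeverConnect.exists_pow_mul_pow {r ρ : ℝ} (hr : 0 < r) (h : NeverConnect r ρ) {p q : ℝ}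
    (hp : 0 < p) (hpq : p < q) : ∃ a b : ℕ, p < r ^ a * ρ ^ b ∧ r ^ a * ρ ^ b < q := by
  have hρ0 : 0 < ρ := one_pos.trans h.2.1
  obtain ⟨a, b, h1, h2⟩ := exists_nat_combination (Real.log_neg hr h.1) (Real.log_pos h.2.1)
    (h.irrational hr) (Real.log_lt_log hp hpq)
  have he : (a : ℝ) * Real.log r + b * Real.log ρ = Real.log (r ^ a * ρ ^ b) := by
    rw [Real.log_mul (by positivity) (by positivity), Real.log_pow, Real.log_pow]
  rw [he] at h1 h2
  exact ⟨a, b, (Real.log_lt_log_iff hp (by positivity)).1 h1,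
    (Real.log_lt_log_iff (by positivity) (hp.trans hpq)).1 h2⟩

end Density

/-! ### The Mahavier product as a Lelek fan. -/

section Mahavier

variable {r ρ : ℝ}

theorem isClosed_unionL (r ρ : ℝ) : IsClosed (unionL r ρ) :=
  IsClosed.union (isClosed_eq (by fun_prop) (by fun_prop))
    (isClosed_eq (by fun_prop) (by fun_prop))

theorem isClosed_mahavierM (r ρ : ℝ) : IsClosed (mahavierM r ρ) := by
  have : mahavierM r ρ = ⋂ i, {x | (x i, x (i + 1)) ∈ unionL r ρ} := by
    ext x
    simp [mahavierM, mahavierProduct]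
  rw [this]
  exact isClosed_iInter fun i => (isClosed_unionL r ρ).preimage (by fun_prop)

instance compactSpace_mahavierM (r ρ : ℝ) : CompactSpace (mahavierM r ρ) :=
  isCompact_iff_compactSpace.1 (isClosed_mahavierM r ρ).isCompact

theorem mahavierM_step (x : mahavierM r ρ) (i : ℕ) :
    ((x.1 (i + 1) : unitInterval) : ℝ) = r * x.1 i ∨ ((x.1 (i + 1) : unitInterval) : ℝ) = ρ * x.1 i :=
  x.2 i

/-- A real sequence in `[0, 1]` with the right steps gives a point of `M_{r,ρ}`. -/
def mahavierMk (s : ℕ → ℝ) (h01 : ∀ i, s i ∈ Icc (0 : ℝ) 1)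
    (hs : ∀ i, s (i + 1) = r * s i ∨ s (i + 1) = ρ * s i) : mahavierM r ρ :=
  ⟨fun i => ⟨s i, h01 i⟩, hs⟩

/-- The vertex of `M_{r,ρ}`. -/
def mahavierTop (r ρ : ℝ) : mahavierM r ρ :=
  mahavierMk (fun _ => 0) (fun _ => ⟨le_rfl, zero_le_one⟩) (fun _ => Or.inl (by simp))

open Classical in
/-- The code of the leg of a point of `M_{r,ρ}`: the sequence of multipliers. -/
noncomputable def mahavierCode (x : mahavierM r ρ) (i : ℕ) : Bool :=
  decide ((x.1 (i + 1) : ℝ) = r * x.1 i)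

theorem continuous_mahavierM_coord (i : ℕ) :
    Continuous fun x : mahavierM r ρ => (x.1 i : ℝ) :=
  continuous_subtype_val.comp ((continuous_apply i).comp continuous_subtype_val)

theorem mahavierM_succ (x : mahavierM r ρ) (i : ℕ) :
    (x.1 (i + 1) : ℝ) = (if mahavierCode x i then r else ρ) * x.1 i := by
  by_cases h : (x.1 (i + 1) : ℝ) = r * x.1 i
  · simp [mahavierCode, h]
  · simpa [mahavierCode, h] using (mahavierM_step x i).resolve_left h

/-- Each side is the product of the first `N` common multipliers with both initial coordinates. The
cross-multiplied form needs no nonzero coordinate. -/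
theorem mahavierM_mul_eq {x y : mahavierM r ρ} (N : ℕ)
    (h : ∀ i < N, mahavierCode x i = mahavierCode y i) :
    (x.1 N : ℝ) * y.1 0 = y.1 N * x.1 0 := by
  induction N with
  | zero => ring
  | succ N ih =>
    rw [mahavierM_succ x, mahavierM_succ y, h N (Nat.lt_succ_self N), mul_assoc, mul_assoc,
      ih fun i hi => h i (hi.trans (Nat.lt_succ_self N))]

theorem mahavierM_pos (hr : 0 < r) (h : NeverConnect r ρ) {x : mahavierM r ρ}
    (hx : 0 < (x.1 0 : ℝ)) (i : ℕ) : 0 < (x.1 i : ℝ) := by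
  have hρ0 : 0 < ρ := one_pos.trans h.2.1
  induction i with
  | zero => exact hx
  | succ i ih =>
    rcases mahavierM_step x i with hs | hs <;> rw [hs] <;> positivity

theorem mahavierM_eq_top {x : mahavierM r ρ} (hx : (x.1 0 : ℝ) = 0) : x = mahavierTop r ρ := by
  apply Subtype.ext
  funext i
  apply Subtype.ext
  change (x.1 i : ℝ) = 0
  induction i with
  | zero => exact hx
  | succ i ih => rw [mahavierM_succ, ih, mul_zero]

/-- Off the top all coordinates are positive, so `r * x i` and `ρ * x i` differ and the multipliers
are locally constant. Scaling a sequence by `t / x 0 ≤ 1` keeps it in the product, which fills the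
legs downwards. -/
theorem fanChart_mahavierM (hr : 0 < r) (h : NeverConnect r ρ) :
    FanChart (mahavierTop r ρ) (fun x => (x.1 0 : ℝ)) mahavierCode := by
  have hρ0 : 0 < ρ := one_pos.trans h.2.1
  refine ⟨continuous_mahavierM_coord 0, fun x => (x.1 0).2.1, rfl, fun x hx => mahavierM_eq_top hx,
    ?_, ?_, ?_⟩
  · refine continuousOn_pi.2 fun i x hx => ContinuousAt.continuousWithinAt ?_
    have hx0 : 0 < (x.1 0 : ℝ) :=
      (x.1 0).2.1.lt_of_ne fun h0 => hx (mahavierM_eq_top h0.symm)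
    by_cases hi : (x.1 (i + 1) : ℝ) = r * x.1 i
    · refine (continuousAt_const (y := true)).congr ?_
      have hne : (x.1 (i + 1) : ℝ) ≠ ρ * x.1 i := by
        rw [hi]
        exact fun he => (h.1.trans h.2.1).ne (mul_right_cancel₀ (mahavierM_pos hr h hx0 i).ne' he)
      have hopen : IsOpen {z : mahavierM r ρ | (z.1 (i + 1) : ℝ) ≠ ρ * z.1 i} :=
        isOpen_ne_fun (continuous_mahavierM_coord _) ((continuous_mahavierM_coord i).const_mul _)
      filter_upwards [hopen.mem_nhds hne] with z hz
      simpa [mahavierCode] using (mahavierM_step z i).resolve_right hz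
    · refine (continuousAt_const (y := false)).congr ?_
      have hopen : IsOpen {z : mahavierM r ρ | (z.1 (i + 1) : ℝ) ≠ r * z.1 i} :=
        isOpen_ne_fun (continuous_mahavierM_coord _) ((continuous_mahavierM_coord i).const_mul _)
      filter_upwards [hopen.mem_nhds hi] with z hz
      simpa [mahavierCode] using hz
  · intro x y hx hy hπ hμ
    have hy0 : (y.1 0 : ℝ) ≠ 0 := fun h0 => hy (mahavierM_eq_top h0)
    apply Subtype.ext
    funext i
    apply Subtype.ext
    have := mahavierM_mul_eq (x := x) (y := y) i fun j _ => congrFun hπ j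
    rw [show (x.1 0 : ℝ) = y.1 0 from hμ] at this
    exact mul_right_cancel₀ hy0 this
  · intro x t ht htx
    have hx0 : 0 < (x.1 0 : ℝ) := ht.trans_le htx
    have hfac : 0 < t / x.1 0 := div_pos ht hx0
    have hfac1 : t / x.1 0 ≤ 1 := (div_le_one hx0).2 htx
    refine ⟨mahavierMk (fun i => t / x.1 0 * x.1 i)
      (fun i => ⟨mul_nonneg hfac.le (x.1 i).2.1, mul_le_one₀ hfac1 (x.1 i).2.1 (x.1 i).2.2⟩) ?_,
      ?_, ?_⟩
    · intro i
      rcases mahavierM_step x i with hs | hs <;> rw [hs]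
      · exact Or.inl (by ring)
      · exact Or.inr (by ring)
    · funext i
      refine decide_eq_decide.2 (?_ : t / x.1 0 * x.1 (i + 1) = r * (t / x.1 0 * x.1 i) ↔ _)
      rw [mul_left_comm]
      exact mul_right_inj' hfac.ne'
    · exact div_mul_cancel₀ _ hx0.ne'

theorem mahavierTop_mem_ramificationPoints (hr : 0 < r) (h : NeverConnect r ρ) :
    mahavierTop r ρ ∈ ramificationPoints (mahavierM r ρ) := by
  have hρ0 : 0 < ρ := one_pos.trans h.2.1
  -- The sequence with multiplier `ρ` at step `k` and `r` at all others. Starting at `ρ⁻¹` keeps it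
  -- below `1`. Different `k` give different codes, hence three legs for a triod.
  let s : ℕ → ℕ → ℝ := fun k i => if i ≤ k then r ^ i * ρ⁻¹ else r ^ (i - 1)
  have hs0 : ∀ k i, 0 < s k i := fun k i => by
    simp only [s]
    split_ifs <;> positivity
  have hs1 : ∀ k i, s k i ≤ 1 := fun k i => by
    simp only [s]
    split_ifs
    · exact mul_le_one₀ (pow_le_one₀ hr.le h.1.le) (by positivity) (inv_le_one_of_one_le₀ h.2.1.le)
    · exact pow_le_one₀ hr.le h.1.le
  have hne : ∀ k i, i ≠ k → s k (i + 1) = r * s k i := by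
    intro k i hik
    simp only [s]
    rcases lt_or_gt_of_ne hik with hlt | hlt
    · rw [if_pos (by omega), if_pos (by omega), pow_succ]
      ring
    · rw [if_neg (by omega), if_neg (by omega), ← pow_succ']
      congr 1
      omega
  have heq : ∀ k, s k (k + 1) = ρ * s k k := by
    intro k
    simp only [s]
    rw [if_neg (by omega), if_pos le_rfl, Nat.add_sub_cancel]
    field_simp
  have hstep : ∀ k i, s k (i + 1) = r * s k i ∨ s k (i + 1) = ρ * s k i := by
    intro k i
    by_cases hik : i = k
    · exact Or.inr (hik ▸ heq k)
    · exact Or.inl (hne k i hik)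
  let x : ℕ → mahavierM r ρ := fun k =>
    mahavierMk (s k) (fun i => ⟨(hs0 k i).le, hs1 k i⟩) (hstep k)
  have hcode : ∀ k i, mahavierCode (x k) i = decide (i ≠ k) := by
    intro k i
    simp only [mahavierCode, decide_eq_decide]
    change s k (i + 1) = r * s k i ↔ i ≠ k
    refine ⟨?_, hne k i⟩
    rintro he rfl
    rw [heq] at he
    exact (h.1.trans h.2.1).ne' (mul_right_cancel₀ (hs0 i i).ne' he)
  refine (fanChart_mahavierM hr h).top_mem_ramificationPoints (fun k : Fin 3 => x k) ?_ ?_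
  · intro k
    exact (fanChart_mahavierM hr h).ne_top (hs0 k 0)
  · intro i j hij he
    have := congrFun he i
    rw [hcode, hcode] at this
    simp only [ne_eq, not_true_eq_false, decide_false] at this
    exact (of_decide_eq_false this.symm) fun he => hij (Fin.ext he)

/-- Sequences in `(0, 1]` with steps `r` and `ρ` that take the value `1`. -/
def ReachesOne (r ρ : ℝ) (s : ℕ → ℝ) : Prop :=
  (∀ i, 0 < s i ∧ s i ≤ 1) ∧ (∀ i, s (i + 1) = r * s i ∨ s (i + 1) = ρ * s i) ∧ ∃ k, s k = 1

theorem ReachesOne.cons {s : ℕ → ℝ} (hs : ReachesOne r ρ s) {w : ℝ} (hw0 : 0 < w) (hw1 : w ≤ 1)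
    (hws : s 0 = r * w ∨ s 0 = ρ * w) : ∃ s', ReachesOne r ρ s' ∧ s' 0 = w := by
  obtain ⟨h1, h2, k, hk⟩ := hs
  refine ⟨fun i => Nat.casesOn i w s, ⟨?_, ?_, k + 1, hk⟩, rfl⟩
  · rintro (_ | i)
    · exact ⟨hw0, hw1⟩
    · exact h1 i
  · rintro (_ | i)
    · exact hws
    · exact h2 i

/-- All steps by `r` are made first, so the values stay at most `1`; the steps by `ρ` then climb to
`1`, and powers of `r` continue the sequence. -/
theorem exists_reachesOne (hr : 0 < r) (hr1 : r < 1) (hρ : 1 < ρ) (a b : ℕ) {w : ℝ} (hw0 : 0 < w)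
    (hw1 : w ≤ 1) (hw : w * (r ^ a * ρ ^ b) = 1) : ∃ s, ReachesOne r ρ s ∧ s 0 = w := by
  have hρ0 : 0 < ρ := one_pos.trans hρ
  induction a generalizing w with
  | zero =>
    induction b generalizing w with
    | zero =>
      refine ⟨fun i => r ^ i, ⟨fun i => ⟨by positivity, pow_le_one₀ hr.le hr1.le⟩,
        fun i => Or.inl (pow_succ' r i), 0, pow_zero r⟩, ?_⟩
      simpa using hw.symm
    | succ b ih =>
      rw [pow_zero, one_mul] at hw
      have hw' : (ρ * w) * (r ^ 0 * ρ ^ b) = 1 := by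
        rw [← hw]
        ring
      have hle : ρ * w ≤ 1 := by
        rw [pow_zero, one_mul] at hw'
        rw [← hw']
        exact le_mul_of_one_le_right (by positivity) (one_le_pow₀ hρ.le)
      obtain ⟨s, hs, hs0⟩ := ih (by positivity) hle hw'
      exact hs.cons hw0 hw1 (Or.inr hs0)
  | succ a ih =>
    obtain ⟨s, hs, hs0⟩ := ih (w := r * w) (by positivity) (mul_le_one₀ hr1.le hw0.le hw1) (by
      rw [← hw]
      ring)
    exact hs.cons hw0 hw1 (Or.inl hs0)

/-- A point of `M_{r,ρ}` with a coordinate `1` is an end-point. -/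
theorem mem_endPoints_of_coord_eq_one (hr : 0 < r) (h : NeverConnect r ρ) {x : mahavierM r ρ}
    {k : ℕ} (hk : (x.1 k : ℝ) = 1) : x ∈ endPoints (mahavierM r ρ) := by
  have hx : x ≠ mahavierTop r ρ := by
    rintro rfl
    exact zero_ne_one hk
  refine (fanChart_mahavierM hr h).mem_endPoints hx fun y hy => ?_
  have h1 := mahavierM_mul_eq (x := y) (y := x) k fun i _ => congrFun hy i
  rw [hk, one_mul] at h1
  rw [← h1]
  exact mul_le_of_le_one_left (x.1 0).2.1 (y.1 k).2.2

theorem exists_endPoint_near (hr : 0 < r) (h : NeverConnect r ρ) {x : mahavierM r ρ}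
    (hx : 0 < (x.1 0 : ℝ)) (N : ℕ) {δ : ℝ} (hδ : 0 < δ) (hδ1 : δ < 1) :
    ∃ y ∈ endPoints (mahavierM r ρ), (∀ i < N, mahavierCode y i = mahavierCode x i) ∧
      δ * x.1 0 ≤ y.1 0 ∧ (y.1 0 : ℝ) ≤ x.1 0 := by
  have hxN := mahavierM_pos hr h hx N
  have hρ0 : 0 < ρ := one_pos.trans h.2.1
  -- The window for `r ^ a * ρ ^ b` is chosen so that scaling `x` by `θ`, with `δ ≤ θ ≤ 1`, brings
  -- coordinate `N` to a value from which `a` steps by `r` and `b` steps by `ρ` lead exactly to `1`.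
  obtain ⟨a, b, h1, h2⟩ := h.exists_pow_mul_pow hr (p := 1 / x.1 N) (q := 1 / (δ * x.1 N))
    (by positivity) (one_div_lt_one_div_of_lt (by positivity)
      (mul_lt_of_lt_one_left hxN hδ1))
  have hE : 0 < r ^ a * ρ ^ b := by positivity
  rw [div_lt_iff₀ hxN] at h1
  rw [lt_div_iff₀ (by positivity)] at h2
  let θ : ℝ := 1 / (x.1 N * (r ^ a * ρ ^ b))
  have hθ0 : 0 < θ := by positivity
  have hθ1 : θ ≤ 1 := by
    refine (div_le_one (by positivity)).2 ?_
    linarith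
  have hθδ : δ ≤ θ := by
    refine (le_div_iff₀ (by positivity)).2 ?_
    linarith
  obtain ⟨s, ⟨hs1, hs2, k, hk⟩, hs0⟩ := exists_reachesOne hr h.1 h.2.1 a b (w := θ * x.1 N)
    (by positivity) (mul_le_one₀ hθ1 hxN.le (x.1 N).2.2) (by
      simp only [θ]
      field_simp)
  let t : ℕ → ℝ := fun i => if i < N then θ * x.1 i else s (i - N)
  have ht : ∀ i ≤ N, t i = θ * x.1 i := by
    intro i hi
    rcases hi.lt_or_eq with hlt | rfl
    · exact if_pos hlt
    · simp only [t, lt_irrefl, if_false, Nat.sub_self, hs0]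
  have ht' : ∀ i, N ≤ i → t i = s (i - N) := fun i hi => if_neg hi.not_gt
  have ht01 : ∀ i, t i ∈ Icc (0 : ℝ) 1 := by
    intro i
    rcases le_total i N with hi | hi
    · rw [ht i hi]
      exact ⟨mul_nonneg hθ0.le (x.1 i).2.1, mul_le_one₀ hθ1 (x.1 i).2.1 (x.1 i).2.2⟩
    · rw [ht' i hi]
      exact ⟨(hs1 _).1.le, (hs1 _).2⟩
  have htstep : ∀ i, t (i + 1) = r * t i ∨ t (i + 1) = ρ * t i := by
    intro i
    rcases lt_or_ge i N with hi | hi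
    · rw [ht i hi.le, ht (i + 1) hi]
      rcases mahavierM_step x i with hs | hs <;> rw [hs]
      · exact Or.inl (by ring)
      · exact Or.inr (by ring)
    · rw [ht' i hi, ht' (i + 1) (by omega), show i + 1 - N = (i - N) + 1 by omega]
      exact hs2 _
  refine ⟨mahavierMk t ht01 htstep, mem_endPoints_of_coord_eq_one hr h (k := N + k) ?_, ?_, ?_, ?_⟩
  · change t (N + k) = 1
    rw [ht' _ (by omega), Nat.add_sub_cancel_left, hk]
  · intro i hi
    simp only [mahavierCode, decide_eq_decide]
    change t (i + 1) = r * t i ↔ _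
    rw [ht i hi.le, ht (i + 1) hi, mul_left_comm]
    exact mul_right_inj' hθ0.ne'
  · change _ ≤ t 0
    rw [ht 0 (Nat.zero_le _)]
    exact mul_le_mul_of_nonneg_right hθδ hx.le
  · change t 0 ≤ _
    rw [ht 0 (Nat.zero_le _)]
    exact mul_le_of_le_one_left hx.le hθ1

/-- Off the top, end-points agreeing with `x` in ever more multipliers and with height ratio tending
to `1` converge to `x`. The top is itself a limit of other points, along any leg. -/
theorem dense_endPoints_mahavierM (hr : 0 < r) (h : NeverConnect r ρ) :
    Dense (endPoints (mahavierM r ρ)) := by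
  have hch := fanChart_mahavierM hr h
  have hne : ∀ x : mahavierM r ρ, x ≠ mahavierTop r ρ → x ∈ closure (endPoints _) := by
    intro x hx
    have hx0 : 0 < (x.1 0 : ℝ) := hch.pos hx
    -- The `2` in the denominator keeps the ratio positive already for `n = 0`.
    have hδ : ∀ n : ℕ, 0 < 1 - 1 / ((n : ℝ) + 2) ∧ 1 - 1 / ((n : ℝ) + 2) < 1 := by
      intro n
      have h2 : (1 : ℝ) / ((n : ℝ) + 2) < 1 := by
        rw [div_lt_one (by positivity)]
        have : (0 : ℝ) ≤ n := n.cast_nonneg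
        linarith
      have h3 : (0 : ℝ) < 1 / ((n : ℝ) + 2) := by positivity
      constructor <;> linarith
    choose y hy1 hy2 hy3 hy4 using fun n => exists_endPoint_near hr h hx0 n (hδ n).1 (hδ n).2
    refine mem_closure_of_tendsto (f := y) (b := atTop) ?_ (Eventually.of_forall hy1)
    refine hch.tendsto ?_ fun _ => ?_
    · refine tendsto_of_tendsto_of_tendsto_of_le_of_le ?_ tendsto_const_nhds hy3 hy4
      have h1 : Tendsto (fun n : ℕ => 1 / ((n : ℝ) + 2)) atTop (𝓝 0) := by
        have := (tendsto_one_div_add_atTop_nhds_zero_nat (𝕜 := ℝ)).comp (tendsto_add_atTop_nat 1)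
        refine this.congr fun n => ?_
        simp only [Function.comp_apply]
        push_cast
        ring
      have h2 := (h1.const_sub 1).mul_const (x.1 0 : ℝ)
      rwa [sub_zero, one_mul] at h2
    · refine tendsto_pi_nhds.2 fun i => tendsto_const_nhds.congr' ?_
      filter_upwards [eventually_gt_atTop i] with n hn
      exact (hy2 n i hn).symm
  intro x
  by_cases hx : x = mahavierTop r ρ
  · obtain ⟨z, hz⟩ := exists_ne_of_mem_ramificationPoints (mahavierTop_mem_ramificationPoints hr h)
    have hz0 := hch.pos hz
    rw [hx, ← hch.legPoint_zero z, ← closure_closure]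
    refine mem_closure_of_tendsto (((hch.continuous_legPoint_left z).tendsto 0).mono_left
      (nhdsWithin_le_nhds (s := Ioi 0))) ?_
    filter_upwards [self_mem_nhdsWithin] with t ht
    refine hne _ (hch.ne_top ?_)
    rw [hch.height_legPoint]
    exact lt_max_of_lt_right (lt_min ht hz0)
  · exact hne x hx

theorem isLelekFan_mahavierM (hr : 0 < r) (h : NeverConnect r ρ) : IsLelekFan (mahavierM r ρ) :=
  ⟨(fanChart_mahavierM hr h).isSmoothFan (mahavierTop_mem_ramificationPoints hr h),
    dense_endPoints_mahavierM hr h⟩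

theorem isArc_inverseRel_unionL (hr : 0 < r) (hr1 : r < 1) (hρ : 1 < ρ) :
    IsArc (inverseRel (unionL r ρ)) := by
  have hρ0 : 0 < ρ := one_pos.trans hρ
  -- The parameter `s` in `[-1, 1]` traces `(-r * s, -s)` on the inverse of `L_r` for `s ≤ 0` and
  -- `(s, s / ρ)` on the inverse of `L_ρ` for `s ≥ 0`. The maxima merge both cases into one
  -- continuous formula.
  let a : ℝ → ℝ := fun s => max (-(r * s)) s
  let b : ℝ → ℝ := fun s => max (-s) (s / ρ)
  have ha1 : ∀ s, s ≤ 0 → a s = -(r * s) := fun s hs => max_eq_left (by nlinarith)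
  have ha2 : ∀ s, 0 ≤ s → a s = s := fun s hs => max_eq_right (by nlinarith)
  have hb1 : ∀ s, s ≤ 0 → b s = -s := fun s hs =>
    max_eq_left ((div_nonpos_of_nonpos_of_nonneg hs hρ0.le).trans (by linarith))
  have hb2 : ∀ s, 0 ≤ s → b s = s / ρ := fun s hs =>
    max_eq_right ((by linarith : -s ≤ 0).trans (by positivity))
  have hdiv : ∀ s, 0 ≤ s → s / ρ ≤ s := fun s hs => div_le_self hs hρ.le
  have ha01 : ∀ s ∈ Icc (-1 : ℝ) 1, a s ∈ Icc (0 : ℝ) 1 := by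
    rintro s ⟨h1, h2⟩
    rcases le_total s 0 with hs | hs
    · rw [ha1 s hs]
      constructor <;> nlinarith
    · rw [ha2 s hs]
      exact ⟨hs, h2⟩
  have hb01 : ∀ s ∈ Icc (-1 : ℝ) 1, b s ∈ Icc (0 : ℝ) 1 := by
    rintro s ⟨h1, h2⟩
    rcases le_total s 0 with hs | hs
    · rw [hb1 s hs]
      constructor <;> linarith
    · rw [hb2 s hs]
      exact ⟨by positivity, (hdiv s hs).trans h2⟩
  let γ : ℝ → unitInterval × unitInterval := fun s =>
    (projIcc 0 1 zero_le_one (a s), projIcc 0 1 zero_le_one (b s))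
  have hγ1 : ∀ s ∈ Icc (-1 : ℝ) 1, ((γ s).1 : ℝ) = a s := fun s hs => by
    simp [γ, projIcc_of_mem _ (ha01 s hs)]
  have hγ2 : ∀ s ∈ Icc (-1 : ℝ) 1, ((γ s).2 : ℝ) = b s := fun s hs => by
    simp [γ, projIcc_of_mem _ (hb01 s hs)]
  have hγ : Continuous γ := by
    have := continuous_projIcc (a := (0 : ℝ)) (b := 1) (h := zero_le_one)
    fun_prop
  have hmix : ∀ s t, s ≤ 0 → 0 < t → a s = a t → b s = b t → False := by
    intro s t hs ht h1 h2
    rw [ha1 s hs, ha2 t ht.le] at h1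
    rw [hb1 s hs, hb2 t ht.le, eq_div_iff hρ0.ne'] at h2
    have h3 : s * (ρ - r) = 0 := by linarith
    rcases mul_eq_zero.1 h3 with h4 | h4
    · rw [h4] at h1
      linarith
    · linarith
  have hinj : InjOn γ (Icc (-1) 1) := by
    intro s hs t ht hst
    have h1 : a s = a t := by rw [← hγ1 s hs, ← hγ1 t ht, hst]
    have h2 : b s = b t := by rw [← hγ2 s hs, ← hγ2 t ht, hst]
    rcases le_or_gt s 0 with h3 | h3 <;> rcases le_or_gt t 0 with h4 | h4
    · rw [hb1 s h3, hb1 t h4] at h2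
      linarith
    · exact (hmix s t h3 h4 h1 h2).elim
    · exact (hmix t s h4 h3 h1.symm h2.symm).elim
    · rwa [ha2 s h3.le, ha2 t h4.le] at h1
  have himg : γ '' Icc (-1) 1 = inverseRel (unionL r ρ) := by
    ext ⟨y, x⟩
    constructor
    · rintro ⟨s, hs, hsp⟩
      have h1 : (y : ℝ) = a s := by rw [← hγ1 s hs, hsp]
      have h2 : (x : ℝ) = b s := by rw [← hγ2 s hs, hsp]
      rcases le_total s 0 with h3 | h3
      · refine Or.inl (show (y : ℝ) = r * x from ?_)
        rw [h1, h2, ha1 s h3, hb1 s h3]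
        ring
      · refine Or.inr (show (y : ℝ) = ρ * x from ?_)
        rw [h1, h2, ha2 s h3, hb2 s h3]
        field_simp
    · rintro (hyx | hyx)
      · have hyx : (y : ℝ) = r * x := hyx
        have hx := x.2
        have hs : -(x : ℝ) ∈ Icc (-1 : ℝ) 1 := ⟨by linarith [hx.2], by linarith [hx.1]⟩
        have hs0 : -(x : ℝ) ≤ 0 := by linarith [hx.1]
        refine ⟨-x, hs, Prod.ext (Subtype.ext ?_) (Subtype.ext ?_)⟩
        · rw [hγ1 _ hs, ha1 _ hs0, hyx]
          ring
        · rw [hγ2 _ hs, hb1 _ hs0, neg_neg]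
      · have hyx : (y : ℝ) = ρ * x := hyx
        have hy := y.2
        have hs : (y : ℝ) ∈ Icc (-1 : ℝ) 1 := ⟨by linarith [hy.1], hy.2⟩
        refine ⟨y, hs, Prod.ext (Subtype.ext ?_) (Subtype.ext ?_)⟩
        · rw [hγ1 _ hs, ha2 _ hy.1]
        · rw [hγ2 _ hs, hb2 _ hy.1, hyx]
          field_simp
  rw [← himg]
  exact (isArcEndpoint_image_Icc (by norm_num) hγ.continuousOn hinj).1.isArc

/-- A closed relation with non-empty sections is the graph of an upper hemicontinuous function. -/
theorem exists_graph_eq {X : Type*} [TopologicalSpace X] [CompactSpace X] [MetrizableSpace X]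
    {G : Set (X × X)} (hG : IsClosed G) (hne : ∀ x, ∃ y, (x, y) ∈ G) :
    ∃ F : X → NonemptyCompacts X, graph F = G ∧ UpperHemicontinuous fun x => (F x : Set X) := by
  have hsec : ∀ x, IsClosed {y | (x, y) ∈ G} := fun x => hG.preimage (by fun_prop)
  refine ⟨fun x => ⟨⟨{y | (x, y) ∈ G}, (hsec x).isCompact⟩, hne x⟩, rfl, ?_⟩
  rw [upperHemicontinuous_iff]
  intro x
  refine UpperHemicontinuousAt.of_sequences (K := univ) isCompact_univ.isSeqCompact
    (Eventually.of_forall fun _ => subset_univ _) fun u hu y hy y₀ hy₀ => ?_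
  exact hG.mem_of_tendsto (hu.prodMk_nhds hy₀) (Eventually.of_forall hy)

end Mahavier
end ContinuumTheory

open ContinuumTheory in
theorem theorem4p9 (r ρ : ℝ) (hr : 0 < r) (h : NeverConnect r ρ) :
    IsLelekFan (mahavierM r ρ) ∧
    IsArc (inverseRel (unionL r ρ)) ∧
    ∃ F : unitInterval → NonemptyCompacts unitInterval,
      graph F = inverseRel (unionL r ρ) ∧
      UpperHemicontinuous (fun x => (F x : Set unitInterval)) ∧
      IsLelekFan (generalizedInverseLimit F) ∧
      ∀ (Y : Type*) [TopologicalSpace Y], IsLelekFan Y →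
        Nonempty (generalizedInverseLimit F ≃ₜ Y) := by
  have hM := isLelekFan_mahavierM hr h
  have hρ0 : 0 < ρ := one_pos.trans h.2.1
  -- Every `y` has the value `y / ρ`, which lies in `[0, 1]` because `ρ > 1`; so no section is
  -- empty.
  obtain ⟨F, hF, hF'⟩ := exists_graph_eq (G := inverseRel (unionL r ρ))
    ((isClosed_unionL r ρ).preimage (by fun_prop)) fun y =>
      ⟨⟨y / ρ, div_nonneg y.2.1 hρ0.le, (div_le_one hρ0).2 (y.2.2.trans h.2.1.le)⟩,
        Or.inr (show (y : ℝ) = ρ * (y / ρ) by field_simp)⟩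
  -- The inverse limit equals the Mahavier product as a set, since inverting the relation and
  -- reversing the roles of consecutive terms cancel.
  have he : generalizedInverseLimit F = mahavierM r ρ := by
    ext x
    refine forall_congr' fun i => ?_
    change (x (i + 1), x i) ∈ graph F ↔ _
    rw [hF]
    rfl
  rw [← he] at hM
  exact ⟨he ▸ hM, isArc_inverseRel_unionL hr h.1 h.2.1, F, hF, hF', hM,
    fun Y _ hY => hM.nonempty_homeomorph hY⟩
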